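/- Let $d\ge 5$ and $\Lambda_N=[-N,N]^d\cap\mathbb Z^d$. Let $\eta=\{\eta(x)\}_{x\in\mathbb Z^d}$ be i.i.d. real random variables with mean $0$ and finite variance on a probability space with measure $\mathbb P$. Let $\mu_N^\eta$ be the finite-volume Gibbs measure on $\mathbb R^{\Lambda_N}$ with zero boundary conditions, $$\mu_N^\eta(d\phi)=\frac1{Z_N^\eta}\exp\Bigl\{-\frac1{4d}\sum_{\{x,y\}\cap\Lambda_N\neq\emptyset,\ |x-y|=1}(\phi(x)-\phi(y))^2+\sum_{x\in\Lambda_N}\eta(x)\phi(x)\Bigr\}\prod_{x\in\Lambda_N}d\phi(x),$$ where each unordered nearest-neighbour pair $\{x,y\}\subset\mathbb Z^d$ is counted once, $\phi(x)=0$ for $x\notin\Lambda_N$, and $Z_N^\eta$ is the normalizing constant; regard $\mu_N^\eta$ as a probability measure on $\mathbb R^{\mathbb Z^d}$ (with the product topology) under which $\phi=0$ outside $\Lambda_N$. Let $G(x,y)=(-\Delta)^{-1}(x,y)=\sum_{n\ge0}P_x(S_n=y)$ be the Green function of the simple random walk $S$ on $\mathbb Z^d$, which is finite. Then for $\mathbb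 P$-almost every $\eta$ the following holds. The series $$m_\infty^\eta(x)=\sum_{y\in\mathbb Z^d}G(x,y)\eta(y):=\lim_{M\to\infty}\sum_{y\in\Lambda_M}G(x,y)\eta(y)$$ converges for every $x\in\mathbb Z^d$; there is a Gaussian probability measure $\mu_\infty^\eta$ on $\mathbb R^{\mathbb Z^d}$ with mean $m_\infty^\eta$ and covariance $(G(x,y))_{x,y\in\mathbb Z^d}$; and $\mu_N^\eta$ converges weakly to $\mu_\infty^\eta$ as $N\to\infty$. -/

import Mathlib

open MeasureTheory ProbabilityTheory Filter Topology

noncomputable section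

namespace DisorderedGFF

/-- The lattice `ℤ^d`. -/
abbrev Site (d : ℕ) : Type := Fin d → ℤ

/-- The box `Λ_N = [-N, N]^d ∩ ℤ^d`. -/
def box (d N : ℕ) : Finset (Site d) :=
  Finset.Icc (fun _ => -(N : ℤ)) (fun _ => (N : ℤ))

/-- Nearest neighbours: the Euclidean distance `|x - y|` is `1`; for lattice points this says that
the sum of the `|x i - y i|` is `1`. -/
def Neighbor {d : ℕ} (x y : Site d) : Prop := ∑ i, |x i - y i| = 1

instance {d : ℕ} (x y : Site d) : Decidable (Neighbor x y) :=
  inferInstanceAs (Decidable (_ = _))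

/-- Extension of a configuration on `Λ_N` by the boundary value `0` outside `Λ_N`. -/
def extendZero (d N : ℕ) (φ : box d N → ℝ) : Site d → ℝ :=
  fun x => if h : x ∈ box d N then φ ⟨x, h⟩ else 0

/-- Ordered nearest neighbour pairs that meet `Λ_N`; such a pair lies in `Λ_{N+1}`. -/
def bonds (d N : ℕ) : Finset (Site d × Site d) :=
  (box d (N + 1) ×ˢ box d (N + 1)).filter
    fun p => Neighbor p.1 p.2 ∧ (p.1 ∈ box d N ∨ p.2 ∈ box d N)

/-- The Hamiltonian `H_N(φ) = (1/4d) ∑_{x,y} (φ(x) - φ(y))²`, over unordered nearest neighbour pairs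
`{x, y}` that meet `Λ_N`, with `φ = 0` outside `Λ_N`. The factor `1/2` compensates for `bonds` listing
each pair in both orders. -/
def hamiltonian (d N : ℕ) (φ : box d N → ℝ) : ℝ :=
  1 / (4 * (d : ℝ)) *
    (1 / 2 * ∑ p ∈ bonds d N, (extendZero d N φ p.1 - extendZero d N φ p.2) ^ 2)

/-- The finite volume Gibbs measure with external field `η` on `ℝ^{Λ_N}`: its density with respect
to Lebesgue measure is `exp (-H_N(φ) + ∑_{x ∈ Λ_N} η(x) φ(x))`, divided by its integral. -/
def gibbsBox (d N : ℕ) (η : Site d → ℝ) : Measure (box d N → ℝ) :=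
  (volume : Measure (box d N → ℝ)).tilted
    fun φ => -hamiltonian d N φ + ∑ x : box d N, η x * φ x

/-- The finite volume Gibbs measure `μ_N^η`, seen as a measure on `ℝ^{ℤ^d}` under which the field
is `0` outside `Λ_N`. -/
def gibbs (d N : ℕ) (η : Site d → ℝ) : Measure (Site d → ℝ) :=
  (gibbsBox d N η).map (extendZero d N)

/-- `P_x(S_n = y)` for the simple random walk `S` on `ℤ^d`, by the first step decomposition. -/
def walkProb {d : ℕ} : ℕ → Site d → Site d → ℝ
  | 0, x, y => if x = y then 1 else 0
  | n + 1, x, y => 1 / (2 * (d : ℝ)) *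
      ∑ i : Fin d, (walkProb n (x + Pi.single i 1) y + walkProb n (x - Pi.single i 1) y)

/-- The Green function `G(x, y) = (-Δ)⁻¹(x, y) = ∑_n P_x(S_n = y)` of the simple random walk. -/
def green {d : ℕ} (x y : Site d) : ℝ := ∑' n, walkProb n x y

/-- `μ` is the law on `ℝ^{ℤ^d}` of the Gaussian field with mean `m` and covariance `C`. -/
structure IsGaussianField {d : ℕ} (μ : Measure (Site d → ℝ)) (m : Site d → ℝ)
    (C : Site d → Site d → ℝ) : Prop where
  gaussian : IsGaussianProcess (fun (x : Site d) (φ : Site d → ℝ) => φ x) μ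
  mean_eq : ∀ x, ∫ φ, φ x ∂μ = m x
  cov_eq : ∀ x y, cov[fun φ : Site d → ℝ => φ x, fun φ : Site d → ℝ => φ y; μ] = C x y

end DisorderedGFF

end

noncomputable section

namespace DisorderedGFF

section walk

variable {d : ℕ}

/-! ### The simple random walk -/

/-! Completing the square shows that the Gibbs measure on the box is Gaussian with covariance
`killGreen N`, the Green function G_N of the walk killed on leaving Λ_N, and mean Σ_y G_N(x,y) η(y).
Two limits remain: that of the fluctuations, which do not involve η, and that of the means, which is
the almost sure statement.

Fluctuations. Let ∇ be the gradient into ℓ² of the edges, normalised so that |∇f|² = ⟨f, -Δf⟩. The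
vectors ∇G_N(·,x) reproduce point values (`inner_gradVec_greenVec`), so for N ≤ M the squared
distance between those of levels N and M is G_M(x,x) - G_N(x,x). Hence they converge as N grows, to
vectors with Gram matrix G. An isonormal Gaussian process W on this ℓ² realises every μ_N on a
single probability space as the law of the mean plus W(∇G_N(·,x)) (`gibbs_eq_map_field`), and
convergence of means and vectors gives weak convergence (`tendsto_map_field`).

Means. Fourier inversion gives P_x(S_n = y) ≤ C n^(-5/2), and from this the tails Σ_{n ≥ K} P_x(S_n
= y) have squared ℓ² norm O(K^(-1/4)) (`exists_sum_greenTail_sq_le`); here d > 4 enters. Both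
families of weights, G_N(x,·) and G(x,·) cut off to Λ_N, increase with N, and their increments are
dominated by such tails. For orthogonal η with equal variances, monotone weights make the variances
of increments superadditive, so a dyadic chaining argument of Rademacher–Menshov type yields almost
sure convergence along all N (`ae_exists_tendsto_of_monotone`). The two limits agree because the
difference tends to 0 along powers of two (`ae_tendsto_zero_two_pow`). -/

theorem walkProb_nonneg (n : ℕ) (x y : Site d) : 0 ≤ walkProb n x y := by
  induction n generalizing x with
  | zero => simp only [walkProb]; split <;> norm_num
  | succ n ih =>
    simp only [walkProb]
    exact mul_nonneg (by positivity) (Finset.sum_nonneg fun i _ => add_nonneg (ih _) (ih _))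

theorem sum_walkProb_le_one (S : Finset (Site d)) (n : ℕ) (x : Site d) :
    ∑ y ∈ S, walkProb n x y ≤ 1 := by
  induction n generalizing x with
  | zero =>
    simp only [walkProb, Finset.sum_ite_eq]
    split <;> norm_num
  | succ n ih =>
    simp only [walkProb]
    rw [← Finset.mul_sum, Finset.sum_comm]
    simp_rw [Finset.sum_add_distrib]
    calc _ ≤ 1 / (2 * (d : ℝ)) * ∑ i : Fin d, ((1 : ℝ) + 1) := by
          rw [← Finset.sum_add_distrib]
          gcongr with i _
          · exact ih _
          · exact ih _
      _ ≤ 1 := by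
          rcases Nat.eq_zero_or_pos d with h | h
          · subst h; simp
          · simp only [Finset.sum_const, Finset.card_univ, Fintype.card_fin, nsmul_eq_mul]
            field_simp
            norm_num

theorem mem_box {N : ℕ} {x : Site d} : x ∈ box d N ↔ ∀ i, |x i| ≤ N := by
  simp only [box, Finset.mem_Icc, Pi.le_def, abs_le]
  exact forall_and.symm

theorem box_mono {M N : ℕ} (h : M ≤ N) : box d M ⊆ box d N := fun x hx =>
  mem_box.2 fun i => (mem_box.1 hx i).trans (by exact_mod_cast h)

theorem exists_mem_box (x : Site d) : ∃ R, x ∈ box d R :=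
  ⟨∑ i, (x i).natAbs, mem_box.2 fun i => by
    rw [Int.abs_eq_natAbs]
    exact_mod_cast Finset.single_le_sum (f := fun i => (x i).natAbs) (fun _ _ => Nat.zero_le _)
      (Finset.mem_univ i)⟩

theorem add_single_mem_box {N : ℕ} {x : Site d} (hx : x ∈ box d N) (i : Fin d) :
    x + Pi.single i 1 ∈ box d (N + 1) := by
  refine mem_box.2 fun j => (abs_add_le _ _).trans ?_
  have := mem_box.1 hx j
  push_cast
  refine add_le_add this ?_
  by_cases h : j = i
  · subst h; simp
  · simp [Pi.single_eq_of_ne h]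

theorem sub_single_mem_box {N : ℕ} {x : Site d} (hx : x ∈ box d N) (i : Fin d) :
    x - Pi.single i 1 ∈ box d (N + 1) := by
  refine mem_box.2 fun j => (abs_sub _ _).trans ?_
  have := mem_box.1 hx j
  push_cast
  refine add_le_add this ?_
  by_cases h : j = i
  · subst h; simp
  · simp [Pi.single_eq_of_ne h]

theorem walkProb_eq_zero {R n N : ℕ} {x y : Site d} (hx : x ∈ box d R) (hn : R + n ≤ N)
    (hy : y ∉ box d N) : walkProb n x y = 0 := by
  induction n generalizing x R with
  | zero =>
    simp only [walkProb, ite_eq_right_iff]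
    rintro rfl
    exact absurd (box_mono (by omega) hx) hy
  | succ n ih =>
    simp only [walkProb]
    rw [Finset.sum_eq_zero, mul_zero]
    intro i _
    rw [ih (add_single_mem_box hx i) (by omega), ih (sub_single_mem_box hx i) (by omega), add_zero]

/-- The probability that the simple random walk started at `x` is at `y` at time `n` and has stayed
in the box `Λ_N` up to then. -/
def killProb (N : ℕ) : ℕ → Site d → Site d → ℝ
  | 0, x, y => if x ∈ box d N then (if x = y then 1 else 0) else 0
  | n + 1, x, y => if x ∈ box d N then 1 / (2 * (d : ℝ)) *
      ∑ i : Fin d, (killProb N n (x + Pi.single i 1) y + killProb N n (x - Pi.single i 1) y) else 0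

theorem killProb_nonneg (N n : ℕ) (x y : Site d) : 0 ≤ killProb N n x y := by
  induction n generalizing x with
  | zero => simp only [killProb]; split_ifs <;> norm_num
  | succ n ih =>
    simp only [killProb]
    split_ifs
    · exact mul_nonneg (by positivity) (Finset.sum_nonneg fun i _ => add_nonneg (ih _) (ih _))
    · exact le_rfl

theorem killProb_mono {M N : ℕ} (h : M ≤ N) (n : ℕ) (x y : Site d) :
    killProb M n x y ≤ killProb N n x y := by
  induction n generalizing x with
  | zero =>
    simp only [killProb]
    split_ifs with h1 h2 h3 h4
    any_goals norm_num
    all_goals exact h3 (box_mono h h1)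
  | succ n ih =>
    by_cases h1 : x ∈ box d M
    · simp only [killProb, if_pos h1, if_pos (box_mono h h1)]
      gcongr with i _
      · exact ih _
      · exact ih _
    · refine le_trans (le_of_eq ?_) (killProb_nonneg _ _ _ _)
      simp only [killProb, if_neg h1]

theorem killProb_le_walkProb (N n : ℕ) (x y : Site d) : killProb N n x y ≤ walkProb n x y := by
  induction n generalizing x with
  | zero =>
    simp only [killProb, walkProb]
    split_ifs <;> norm_num
  | succ n ih =>
    by_cases h1 : x ∈ box d N
    · simp only [killProb, walkProb, if_pos h1]
      gcongr with i _
      · exact ih _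
      · exact ih _
    · refine le_trans (le_of_eq ?_) (walkProb_nonneg _ _ _)
      simp only [killProb, if_neg h1]

theorem killProb_eq_walkProb {R n N : ℕ} {x : Site d} (hx : x ∈ box d R) (hn : R + n ≤ N)
    (y : Site d) : killProb N n x y = walkProb n x y := by
  have hN : x ∈ box d N := box_mono (by omega) hx
  induction n generalizing x R with
  | zero => simp only [killProb, walkProb, if_pos hN]
  | succ n ih =>
    simp only [killProb, walkProb, if_pos hN]
    congr 1
    refine Finset.sum_congr rfl fun i _ => ?_
    rw [ih (add_single_mem_box hx i) (by omega) (box_mono (by omega) (add_single_mem_box hx i)),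
      ih (sub_single_mem_box hx i) (by omega) (box_mono (by omega) (sub_single_mem_box hx i))]

theorem killProb_of_notMem_left {N : ℕ} {x : Site d} (hx : x ∉ box d N) (n : ℕ) (y : Site d) :
    killProb N n x y = 0 := by
  cases n <;> simp only [killProb, if_neg hx]

theorem killProb_of_notMem_right {N : ℕ} {y : Site d} (hy : y ∉ box d N) (n : ℕ) (x : Site d) :
    killProb N n x y = 0 := by
  induction n generalizing x with
  | zero =>
    simp only [killProb]
    split_ifs with h1 h2
    · exact absurd (h2 ▸ h1) hy
    all_goals rfl
  | succ n ih => simp [killProb, ih]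

/-! ### Heat kernel bound by Fourier inversion -/

/-- Lebesgue measure on the torus `(-π, π]^d`. -/
def torus (d : ℕ) : Measure (Fin d → ℝ) :=
  Measure.pi fun _ => volume.restrict (Set.Ioc (-Real.pi) Real.pi)

instance : IsFiniteMeasure (torus d) := by unfold torus; infer_instance

/-- The characteristic function of a step of the simple random walk. -/
def stepChar (θ : Fin d → ℝ) : ℝ := 1 / (d : ℝ) * ∑ i, Real.cos (θ i)

theorem abs_stepChar_le_one (θ : Fin d → ℝ) : |stepChar θ| ≤ 1 := by
  unfold stepChar
  rw [abs_mul, abs_of_nonneg (by positivity)]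
  calc _ ≤ 1 / (d : ℝ) * ∑ i : Fin d, (1 : ℝ) := by
        gcongr
        exact (Finset.abs_sum_le_sum_abs _ _).trans
          (Finset.sum_le_sum fun i _ => Real.abs_cos_le_one _)
    _ ≤ 1 := by
        simp only [Finset.sum_const, Finset.card_univ, Fintype.card_fin, nsmul_eq_mul, mul_one]
        rw [one_div]
        exact inv_mul_le_one

/-- The modulus of the characteristic function is 1 both at 0 and at (π, …, π), by parity of the
walk. Bounding by sin² instead of θ² treats both points at once and factorises over coordinates. -/
theorem abs_stepChar_le_exp (hd : 0 < d) (θ : Fin d → ℝ) :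
    |stepChar θ| ≤ Real.exp (-(1 / (2 * (d : ℝ))) * ∑ i, Real.sin (θ i) ^ 2) := by
  have hd' : (0 : ℝ) < d := by exact_mod_cast hd
  -- With c = |cos t| this is c ≤ (1 + c²)/2.
  have h1 : ∀ t : ℝ, |Real.cos t| ≤ 1 - Real.sin t ^ 2 / 2 := fun t => by
    have := Real.sin_sq_add_cos_sq t
    rw [← sq_abs (Real.cos t)] at this
    nlinarith [sq_nonneg (1 - |Real.cos t|)]
  unfold stepChar
  rw [abs_mul, abs_of_nonneg (by positivity)]
  calc _ ≤ 1 / (d : ℝ) * ∑ i : Fin d, (1 - Real.sin (θ i) ^ 2 / 2) := by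
        gcongr
        exact (Finset.abs_sum_le_sum_abs _ _).trans (Finset.sum_le_sum fun i _ => h1 _)
    _ = -(1 / (2 * (d : ℝ))) * ∑ i, Real.sin (θ i) ^ 2 + 1 := by
        rw [Finset.sum_sub_distrib, ← Finset.sum_div]
        simp only [Finset.sum_const, Finset.card_univ, Fintype.card_fin, nsmul_eq_mul, mul_one]
        field_simp
        ring
    _ ≤ _ := Real.add_one_le_exp _

theorem continuous_stepChar : Continuous (stepChar : (Fin d → ℝ) → ℝ) := by
  unfold stepChar; fun_prop

theorem integral_cexp_int (k : ℤ) :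
    ∫ t in Set.Ioc (-Real.pi) Real.pi, Complex.exp ((k : ℂ) * Complex.I * t) =
      if k = 0 then (2 * Real.pi : ℂ) else 0 := by
  rw [← intervalIntegral.integral_of_le (by linarith [Real.pi_pos])]
  split_ifs with h
  · subst h
    simp
    ring
  · have hc : (k : ℂ) * Complex.I ≠ 0 := by simp [h]
    rw [integral_exp_mul_complex hc, div_eq_zero_iff]
    left
    rw [sub_eq_zero, Complex.exp_eq_exp_iff_exists_int]
    exact ⟨k, by push_cast; ring⟩

/-- Orthogonality of characters: the complex exponential factorises over coordinates, and the cosine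
is its real part. -/
theorem integral_cos_torus (z : Site d) :
    ∫ θ, Real.cos (∑ i, θ i * z i) ∂torus d = if z = 0 then (2 * Real.pi) ^ d else 0 := by
  have h1 : ∫ θ, Complex.exp ((∑ i, θ i * z i : ℝ) * Complex.I) ∂torus d =
      if z = 0 then ((2 * Real.pi : ℂ)) ^ d else 0 := by
    have : ∀ θ : Fin d → ℝ, Complex.exp ((∑ i, θ i * z i : ℝ) * Complex.I) =
        ∏ i, Complex.exp ((z i : ℂ) * Complex.I * θ i) := fun θ => by
      rw [← Complex.exp_sum]
      congr 1
      push_cast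
      rw [Finset.sum_mul]
      exact Finset.sum_congr rfl fun i _ => by ring
    simp_rw [this]
    unfold torus
    rw [integral_fintype_prod_eq_prod (𝕜 := ℂ)
      (f := fun i (t : ℝ) => Complex.exp ((z i : ℂ) * Complex.I * t))]
    simp_rw [integral_cexp_int]
    split_ifs with h
    · subst h; simp
    · obtain ⟨i, hi⟩ := Function.ne_iff.1 h
      exact Finset.prod_eq_zero (Finset.mem_univ i) (if_neg hi)
  have h2 : ∫ θ, Real.cos (∑ i, θ i * z i) ∂torus d =
      (∫ θ, Complex.exp ((∑ i, θ i * z i : ℝ) * Complex.I) ∂torus d).re := by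
    rw [← RCLike.re_eq_complex_re, ← integral_re]
    · refine integral_congr_ae (Eventually.of_forall fun θ => ?_)
      simp only [RCLike.re_eq_complex_re, Complex.exp_ofReal_mul_I_re]
    · refine Integrable.of_bound (C := 1) ?_ (Eventually.of_forall fun θ => ?_)
      · exact Continuous.aestronglyMeasurable (by fun_prop)
      · rw [Complex.norm_exp_ofReal_mul_I]
  rw [h2, h1]
  split_ifs
  · have : ((2 * Real.pi : ℂ)) ^ d = (((2 * Real.pi) ^ d : ℝ) : ℂ) := by push_cast; rfl
    rw [this, Complex.ofReal_re]
  · rfl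

theorem integrable_stepChar_pow_mul_cos (n : ℕ) (z : Site d) :
    Integrable (fun θ => stepChar θ ^ n * Real.cos (∑ i, θ i * z i)) (torus d) := by
  refine Integrable.of_bound (C := 1) ?_ (Eventually.of_forall fun θ => ?_)
  · have := continuous_stepChar (d := d)
    exact Continuous.aestronglyMeasurable (by fun_prop)
  · rw [Real.norm_eq_abs, abs_mul, abs_pow]
    exact mul_le_one₀ (pow_le_one₀ (abs_nonneg _) (abs_stepChar_le_one θ)) (abs_nonneg _)
      (Real.abs_cos_le_one _)

/-- Fourier inversion by induction on the time: averaging cos(θ·(x ± e_i - y)) over the steps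
multiplies cos(θ·(x - y)) by `stepChar θ`. -/
theorem walkProb_eq_integral (n : ℕ) (x y : Site d) :
    walkProb n x y = ((2 * Real.pi) ^ d)⁻¹ *
      ∫ θ, stepChar θ ^ n * Real.cos (∑ i, θ i * (x - y) i) ∂torus d := by
  have hpi : (2 * Real.pi) ^ d ≠ 0 := by positivity
  induction n generalizing x with
  | zero =>
    simp only [walkProb, pow_zero, one_mul]
    rw [integral_cos_torus]
    by_cases h : x = y
    · simp [h]
    · rw [if_neg h, if_neg (sub_ne_zero.2 h), mul_zero]
  | succ n ih =>
    simp only [walkProb, ih]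
    have key : ∀ θ : Fin d → ℝ, ∀ i,
        Real.cos (∑ j, θ j * (x + Pi.single i 1 - y : Site d) j) +
          Real.cos (∑ j, θ j * (x - Pi.single i 1 - y : Site d) j) =
        2 * Real.cos (θ i) * Real.cos (∑ j, θ j * (x - y) j) := fun θ i => by
      have e1 : ∑ j, θ j * (x + Pi.single i 1 - y : Site d) j =
          ∑ j, θ j * (x - y) j + θ i := by
        have : θ i = ∑ j, θ j * ((Pi.single i 1 : Site d) j : ℤ) := by
          rw [Finset.sum_eq_single i]
          · simp
          · intro j _ hj; simp [Pi.single_eq_of_ne hj]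
          · simp
        conv_rhs => rw [this]
        rw [← Finset.sum_add_distrib]
        refine Finset.sum_congr rfl fun j _ => ?_
        simp only [Pi.add_apply, Pi.sub_apply]
        push_cast
        ring
      have e2 : ∑ j, θ j * (x - Pi.single i 1 - y : Site d) j =
          ∑ j, θ j * (x - y) j - θ i := by
        have : θ i = ∑ j, θ j * ((Pi.single i 1 : Site d) j : ℤ) := by
          rw [Finset.sum_eq_single i]
          · simp
          · intro j _ hj; simp [Pi.single_eq_of_ne hj]
          · simp
        conv_rhs => rw [this]
        rw [← Finset.sum_sub_distrib]
        refine Finset.sum_congr rfl fun j _ => ?_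
        simp only [Pi.sub_apply]
        push_cast
        ring
      rw [e1, e2, Real.cos_add, Real.cos_sub]
      ring
    have h1 : ∀ i : Fin d,
        (∫ θ, stepChar θ ^ n * Real.cos (∑ j, θ j * (x + Pi.single i 1 - y : Site d) j) ∂torus d) +
        (∫ θ, stepChar θ ^ n * Real.cos (∑ j, θ j * (x - Pi.single i 1 - y : Site d) j) ∂torus d) =
        ∫ θ, stepChar θ ^ n * (2 * Real.cos (θ i) * Real.cos (∑ j, θ j * (x - y) j))
          ∂torus d := fun i => by
      rw [← integral_add (integrable_stepChar_pow_mul_cos _ _)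
        (integrable_stepChar_pow_mul_cos _ _)]
      simp_rw [← mul_add, key]
    simp_rw [← mul_add, h1, ← Finset.mul_sum]
    rw [← integral_finsetSum]
    · rw [mul_left_comm, ← integral_const_mul]
      congr 2
      funext θ
      rw [← Finset.mul_sum, ← Finset.sum_mul, ← Finset.mul_sum, pow_succ]
      generalize stepChar θ ^ n = A
      rw [stepChar, one_div, mul_inv, one_div]
      ring
    · intro i _
      simp_rw [← key, mul_add]
      exact (integrable_stepChar_pow_mul_cos _ _).add (integrable_stepChar_pow_mul_cos _ _)

/-- The zeros of sin in [-π, π] are -π, 0 and π. One of them lies within π/2 of t, and Jordan's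
inequality |sin s| ≥ (2/π)|s| applies to the displacement s from it. -/
theorem exp_neg_mul_sin_sq_le {a t : ℝ} (ha : 0 < a) (h1 : -Real.pi ≤ t) (h2 : t ≤ Real.pi) :
    Real.exp (-a * Real.sin t ^ 2) ≤
      Real.exp (-(a * (4 / Real.pi ^ 2)) * (t + Real.pi) ^ 2) +
      Real.exp (-(a * (4 / Real.pi ^ 2)) * t ^ 2) +
      Real.exp (-(a * (4 / Real.pi ^ 2)) * (t - Real.pi) ^ 2) := by
  have hpi := Real.pi_pos
  have key : ∀ s : ℝ, |s| ≤ Real.pi / 2 → Real.sin s ^ 2 = Real.sin t ^ 2 →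
      Real.exp (-a * Real.sin t ^ 2) ≤ Real.exp (-(a * (4 / Real.pi ^ 2)) * s ^ 2) := by
    intro s hs hst
    have := Real.mul_abs_le_abs_sin hs
    rw [Real.exp_le_exp, ← hst, neg_mul, neg_mul, neg_le_neg_iff, mul_assoc]
    gcongr
    calc 4 / Real.pi ^ 2 * s ^ 2 = (2 / Real.pi * |s|) ^ 2 := by
          rw [mul_pow, sq_abs]; ring
      _ ≤ |Real.sin s| ^ 2 := by gcongr
      _ = _ := sq_abs _
  have e1 := Real.exp_pos (-(a * (4 / Real.pi ^ 2)) * (t + Real.pi) ^ 2)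
  have e2 := Real.exp_pos (-(a * (4 / Real.pi ^ 2)) * t ^ 2)
  have e3 := Real.exp_pos (-(a * (4 / Real.pi ^ 2)) * (t - Real.pi) ^ 2)
  rcases le_total t (-(Real.pi / 2)) with h | h
  · have := key (t + Real.pi) (abs_le.2 ⟨by linarith, by linarith⟩) (by simp [Real.sin_add_pi])
    linarith
  rcases le_total t (Real.pi / 2) with h' | h'
  · have := key t (abs_le.2 ⟨by linarith, by linarith⟩) rfl
    linarith
  · have := key (t - Real.pi) (abs_le.2 ⟨by linarith, by linarith⟩) (by simp [Real.sin_sub_pi])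
    linarith

theorem integral_exp_neg_mul_sin_sq_le {a : ℝ} (ha : 0 < a) :
    ∫ t in Set.Ioc (-Real.pi) Real.pi, Real.exp (-a * Real.sin t ^ 2) ≤
      3 * √(Real.pi / (a * (4 / Real.pi ^ 2))) := by
  have hb : 0 < a * (4 / Real.pi ^ 2) := by positivity
  set b := a * (4 / Real.pi ^ 2)
  have i0 := integrable_exp_neg_mul_sq hb
  have i1 : Integrable fun t : ℝ => Real.exp (-b * (t + Real.pi) ^ 2) := i0.comp_add_right Real.pi
  have i2 : Integrable fun t : ℝ => Real.exp (-b * (t - Real.pi) ^ 2) := i0.comp_sub_right Real.pi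
  have v1 : ∫ t : ℝ, Real.exp (-b * (t + Real.pi) ^ 2) = √(Real.pi / b) := by
    rw [integral_add_right_eq_self (fun t : ℝ => Real.exp (-b * t ^ 2)), integral_gaussian]
  have v2 : ∫ t : ℝ, Real.exp (-b * (t - Real.pi) ^ 2) = √(Real.pi / b) := by
    rw [integral_sub_right_eq_self (fun t : ℝ => Real.exp (-b * t ^ 2)), integral_gaussian]
  calc _ ≤ ∫ t in Set.Ioc (-Real.pi) Real.pi, (Real.exp (-b * (t + Real.pi) ^ 2) +
        Real.exp (-b * t ^ 2) + Real.exp (-b * (t - Real.pi) ^ 2)) := by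
        refine setIntegral_mono_on ?_ ?_ measurableSet_Ioc fun t ht =>
          exp_neg_mul_sin_sq_le ha ht.1.le ht.2
        · exact (Continuous.integrableOn_Icc (by fun_prop)).mono_set Set.Ioc_subset_Icc_self
        · exact ((i1.add i0).add i2).integrableOn
    _ ≤ ∫ t : ℝ, (Real.exp (-b * (t + Real.pi) ^ 2) +
        Real.exp (-b * t ^ 2) + Real.exp (-b * (t - Real.pi) ^ 2)) :=
        setIntegral_le_integral ((i1.add i0).add i2) (Eventually.of_forall fun t => by positivity)
    _ = _ := by
        have e1 := integral_add (i1.add i0) i2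
        simp only [Pi.add_apply] at e1
        rw [e1, integral_add i1 i0, v1, v2, integral_gaussian]
        ring

/-- The Fourier integral is dominated by a product of d one-dimensional integrals, each of order
n^(-1/2). Only five of these factors are kept, the others being absorbed by √(1/n) ≤ 1. -/
theorem exists_walkProb_le (hd : 5 ≤ d) :
    ∃ C : ℝ, 0 ≤ C ∧ ∀ n : ℕ, 1 ≤ n → ∀ x y : Site d, walkProb n x y ≤ C * √(1 / n) ^ 5 := by
  have hd' : (0 : ℝ) < d := by exact_mod_cast (by omega : 0 < d)
  refine ⟨((2 * Real.pi) ^ d)⁻¹ * (3 * √(Real.pi ^ 3 * d / 2)) ^ d, by positivity, ?_⟩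
  intro n hn x y
  have hn' : (1 : ℝ) ≤ n := by exact_mod_cast hn
  set a : ℝ := n * (1 / (2 * (d : ℝ)))
  have ha : 0 < a := by positivity
  have h1 : ∫ θ, ∏ i, Real.exp (-a * Real.sin (θ i) ^ 2) ∂torus d =
      (∫ t in Set.Ioc (-Real.pi) Real.pi, Real.exp (-a * Real.sin t ^ 2)) ^ d := by
    unfold torus
    rw [integral_fintype_prod_eq_prod (𝕜 := ℝ)
      (f := fun (_ : Fin d) (t : ℝ) => Real.exp (-a * Real.sin t ^ 2))]
    simp
  have h2 : ∫ θ, stepChar θ ^ n * Real.cos (∑ i, θ i * (x - y) i) ∂torus d ≤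
      ∫ θ, ∏ i, Real.exp (-a * Real.sin (θ i) ^ 2) ∂torus d := by
    refine integral_mono (integrable_stepChar_pow_mul_cos _ _) ?_ fun θ => ?_
    · refine Integrable.of_bound (C := 1) (Continuous.aestronglyMeasurable (by fun_prop))
        (Eventually.of_forall fun θ => ?_)
      rw [Real.norm_eq_abs, abs_of_nonneg (Finset.prod_nonneg fun i _ => (Real.exp_pos _).le)]
      refine Finset.prod_le_one (fun i _ => (Real.exp_pos _).le) fun i _ => ?_
      rw [Real.exp_le_one_iff]
      have : 0 ≤ a * Real.sin (θ i) ^ 2 := by positivity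
      linarith
    · calc stepChar θ ^ n * Real.cos (∑ i, θ i * (x - y) i)
          ≤ |stepChar θ ^ n * Real.cos (∑ i, θ i * (x - y) i)| := le_abs_self _
        _ ≤ |stepChar θ| ^ n := by
            rw [abs_mul, abs_pow]
            exact mul_le_of_le_one_right (by positivity) (Real.abs_cos_le_one _)
        _ ≤ Real.exp (-(1 / (2 * (d : ℝ))) * ∑ i, Real.sin (θ i) ^ 2) ^ n := by
            gcongr
            exact abs_stepChar_le_exp (by omega) θ
        _ = ∏ i, Real.exp (-a * Real.sin (θ i) ^ 2) := by
            rw [← Real.exp_nat_mul, ← Real.exp_sum, ← Finset.mul_sum]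
            congr 1
            ring
  have h3 := integral_exp_neg_mul_sin_sq_le ha
  have h4 : √(Real.pi / (a * (4 / Real.pi ^ 2))) = √(Real.pi ^ 3 * d / 2) * √(1 / n) := by
    rw [← Real.sqrt_mul (by positivity)]
    congr 1
    simp only [a]
    field_simp
    ring
  have h5 : √(1 / (n : ℝ)) ≤ 1 := by
    rw [Real.sqrt_le_one]
    exact (div_le_one (by positivity)).2 hn'
  rw [walkProb_eq_integral, mul_assoc]
  refine mul_le_mul_of_nonneg_left ?_ (by positivity)
  calc _ ≤ _ := h2
    _ = _ := h1
    _ ≤ (3 * √(Real.pi / (a * (4 / Real.pi ^ 2)))) ^ d :=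
        pow_le_pow_left₀ (integral_nonneg fun t => (Real.exp_pos _).le) h3 d
    _ = (3 * √(Real.pi ^ 3 * d / 2)) ^ d * √(1 / n) ^ d := by
        rw [h4, ← mul_assoc, mul_pow]
    _ ≤ _ := mul_le_mul_of_nonneg_left (pow_le_pow_of_le_one (by positivity) h5 hd) (by positivity)

/-! ### The Green function and its finite volume version -/

theorem summable_walkProb (hd : 5 ≤ d) (x y : Site d) : Summable fun n => walkProb n x y := by
  obtain ⟨C, hC, h⟩ := exists_walkProb_le hd
  rw [← summable_nat_add_iff 1]
  have hs : Summable fun n : ℕ => C * (1 / ((n + 1 : ℕ) : ℝ) ^ (3 / 2 : ℝ)) :=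
    ((summable_nat_add_iff 1).2 (Real.summable_one_div_nat_rpow.2 (by norm_num))).mul_left C
  refine hs.of_nonneg_of_le (fun n => walkProb_nonneg _ _ _) fun n => ?_
  refine (h (n + 1) (by omega) x y).trans (mul_le_mul_of_nonneg_left ?_ hC)
  have h1 : (1 : ℝ) ≤ ((n + 1 : ℕ) : ℝ) := by exact_mod_cast Nat.succ_pos n
  have h2 : √(1 / ((n + 1 : ℕ) : ℝ)) ≤ 1 :=
    Real.sqrt_le_one.2 ((div_le_one (by positivity)).2 h1)
  calc _ ≤ √(1 / ((n + 1 : ℕ) : ℝ)) ^ 3 := pow_le_pow_of_le_one (by positivity) h2 (by norm_num)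
    _ = _ := by
      rw [Real.sqrt_eq_rpow, ← Real.rpow_natCast, ← Real.rpow_mul (by positivity),
        Real.div_rpow zero_le_one (by positivity), Real.one_rpow]
      norm_num

/-- The tail `∑_{n ≥ K} P_x(S_n = y)` of the Green function. -/
def greenTail (K : ℕ) (x y : Site d) : ℝ := ∑' n, walkProb (n + K) x y

theorem greenTail_nonneg (K : ℕ) (x y : Site d) : 0 ≤ greenTail K x y :=
  tsum_nonneg fun _ => walkProb_nonneg _ _ _

/-- A weighted Cauchy–Schwarz inequality in n reduces the claim to Σ_y P_x(S_n = y)², which is at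
most sup_y P_x(S_n = y) = O(n^(-5/2)). -/
theorem exists_sum_greenTail_sq_le (hd : 5 ≤ d) :
    ∃ C : ℝ, 0 ≤ C ∧ ∀ K : ℕ, 1 ≤ K → ∀ (S : Finset (Site d)) (x : Site d),
      ∑ y ∈ S, greenTail K x y ^ 2 ≤ C * (1 / (K : ℝ) ^ (1 / 4 : ℝ)) := by
  obtain ⟨C, hC, h⟩ := exists_walkProb_le hd
  -- The exponent 9/8 exceeds 1, so the weights are summable, and 5/2 = 2·(9/8) + 1/4 leaves
  -- n^(-1/4) to spare as the rate.
  set w : ℕ → ℝ := fun n => 1 / (n : ℝ) ^ (9 / 8 : ℝ) with hw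
  have hws : Summable w := Real.summable_one_div_nat_rpow.2 (by norm_num)
  have hw0 : ∀ n, 0 ≤ w n := fun n => by positivity
  refine ⟨(∑' n, w n) * (∑' n, w n) * C,
    mul_nonneg (mul_nonneg (tsum_nonneg hw0) (tsum_nonneg hw0)) hC, ?_⟩
  intro K hK S x
  have hK' : (0 : ℝ) < K := by exact_mod_cast hK
  have hwp : ∀ n, 0 < w (n + K) := fun n => by
    have : (0 : ℝ) < ((n + K : ℕ) : ℝ) := by exact_mod_cast (by omega : 0 < n + K)
    positivity
  have hpart : ∀ L, ∑ n ∈ Finset.range L, w (n + K) ≤ ∑' n, w n := fun L => by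
    refine (((summable_nat_add_iff K).2 hws).sum_le_tsum _ fun n _ => hw0 _).trans ?_
    have := hws.sum_add_tsum_nat_add K
    have h0 : 0 ≤ ∑ n ∈ Finset.range K, w n := Finset.sum_nonneg fun n _ => hw0 n
    linarith
  have hsq : ∀ n, ∑ y ∈ S, walkProb (n + K) x y ^ 2 ≤
      C * (1 / (K : ℝ) ^ (1 / 4 : ℝ)) * w (n + K) ^ 2 := fun n => by
    have hnK : (0 : ℝ) < ((n + K : ℕ) : ℝ) := by exact_mod_cast (by omega : 0 < n + K)
    calc ∑ y ∈ S, walkProb (n + K) x y ^ 2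
        ≤ ∑ y ∈ S, C * √(1 / (n + K : ℕ)) ^ 5 * walkProb (n + K) x y := by
          refine Finset.sum_le_sum fun y _ => ?_
          rw [sq]
          exact mul_le_mul_of_nonneg_right (h _ (by omega) x y) (walkProb_nonneg _ _ _)
      _ ≤ C * √(1 / (n + K : ℕ)) ^ 5 * 1 := by
          rw [← Finset.mul_sum]
          exact mul_le_mul_of_nonneg_left (sum_walkProb_le_one S _ x) (by positivity)
      _ = C * (1 / ((n + K : ℕ) : ℝ) ^ (1 / 4 : ℝ)) * w (n + K) ^ 2 := by
          rw [hw, mul_one, mul_assoc]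
          congr 1
          simp only
          rw [Real.sqrt_eq_rpow, ← Real.rpow_natCast, ← Real.rpow_mul (by positivity),
            Real.div_rpow zero_le_one (by positivity), Real.one_rpow, div_pow, one_pow,
            ← Real.rpow_natCast (_ ^ (9 / 8 : ℝ)), ← Real.rpow_mul hnK.le, div_mul_div_comm,
            ← Real.rpow_add hnK]
          norm_num
      _ ≤ _ := by
          gcongr
          omega
  have hfin : ∀ L : ℕ, ∑ y ∈ S, (∑ n ∈ Finset.range L, walkProb (n + K) x y) ^ 2 ≤
      (∑' n, w n) * (∑' n, w n) * C * (1 / (K : ℝ) ^ (1 / 4 : ℝ)) := fun L => by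
    calc ∑ y ∈ S, (∑ n ∈ Finset.range L, walkProb (n + K) x y) ^ 2
        ≤ ∑ y ∈ S, (∑ n ∈ Finset.range L, w (n + K)) *
            ∑ n ∈ Finset.range L, walkProb (n + K) x y ^ 2 / w (n + K) := by
          refine Finset.sum_le_sum fun y _ => ?_
          refine Finset.sum_sq_le_sum_mul_sum_of_sq_le_mul _ (fun n _ => hw0 _)
            (fun n _ => div_nonneg (sq_nonneg _) (hw0 _)) fun n _ => ?_
          rw [mul_div_cancel₀ _ (hwp n).ne']
      _ = (∑ n ∈ Finset.range L, w (n + K)) *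
            ∑ n ∈ Finset.range L, (∑ y ∈ S, walkProb (n + K) x y ^ 2) / w (n + K) := by
          rw [← Finset.mul_sum, Finset.sum_comm]
          simp_rw [Finset.sum_div]
      _ ≤ (∑ n ∈ Finset.range L, w (n + K)) *
            ∑ n ∈ Finset.range L, C * (1 / (K : ℝ) ^ (1 / 4 : ℝ)) * w (n + K) := by
          refine mul_le_mul_of_nonneg_left ?_ (Finset.sum_nonneg fun n _ => hw0 _)
          refine Finset.sum_le_sum fun n _ => ?_
          rw [div_le_iff₀ (hwp n), mul_assoc, ← sq]
          exact hsq n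
      _ ≤ (∑' n, w n) * (C * (1 / (K : ℝ) ^ (1 / 4 : ℝ)) * ∑' n, w n) := by
          rw [← Finset.mul_sum]
          have := hpart L
          have h0 : 0 ≤ ∑ n ∈ Finset.range L, w (n + K) := Finset.sum_nonneg fun n _ => hw0 _
          gcongr
      _ = _ := by ring
  have hlim : Tendsto (fun L => ∑ y ∈ S, (∑ n ∈ Finset.range L, walkProb (n + K) x y) ^ 2) atTop
      (𝓝 (∑ y ∈ S, greenTail K x y ^ 2)) := tendsto_finsetSum _ fun y _ =>
    (((summable_nat_add_iff K).2 (summable_walkProb hd x y)).hasSum.tendsto_sum_nat).pow 2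
  exact le_of_tendsto hlim (Eventually.of_forall hfin)

/-- The Green function of the simple random walk killed upon leaving `Λ_N`. -/
def killGreen (N : ℕ) (x y : Site d) : ℝ := ∑' n, killProb N n x y

theorem summable_killProb (hd : 5 ≤ d) (N : ℕ) (x y : Site d) :
    Summable fun n => killProb N n x y :=
  (summable_walkProb hd x y).of_nonneg_of_le (fun _ => killProb_nonneg _ _ _ _)
    fun _ => killProb_le_walkProb _ _ _ _

theorem killGreen_nonneg (N : ℕ) (x y : Site d) : 0 ≤ killGreen N x y :=
  tsum_nonneg fun _ => killProb_nonneg _ _ _ _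

theorem killGreen_mono (hd : 5 ≤ d) {M N : ℕ} (h : M ≤ N) (x y : Site d) :
    killGreen M x y ≤ killGreen N x y :=
  (summable_killProb hd M x y).tsum_le_tsum (fun n => killProb_mono h n x y)
    (summable_killProb hd N x y)

theorem killGreen_le_green (hd : 5 ≤ d) (N : ℕ) (x y : Site d) : killGreen N x y ≤ green x y :=
  (summable_killProb hd N x y).tsum_le_tsum (fun n => killProb_le_walkProb N n x y)
    (summable_walkProb hd x y)

theorem killGreen_of_notMem_left {N : ℕ} {x : Site d} (hx : x ∉ box d N) (y : Site d) :
    killGreen N x y = 0 := by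
  simp [killGreen, killProb_of_notMem_left hx]

theorem killGreen_of_notMem_right {N : ℕ} {y : Site d} (hy : y ∉ box d N) (x : Site d) :
    killGreen N x y = 0 := by
  simp [killGreen, killProb_of_notMem_right hy]

theorem killGreen_eq (hd : 5 ≤ d) {N : ℕ} {x : Site d} (hx : x ∈ box d N) (y : Site d) :
    killGreen N x y = (if x = y then 1 else 0) + 1 / (2 * (d : ℝ)) *
      ∑ i : Fin d, (killGreen N (x + Pi.single i 1) y + killGreen N (x - Pi.single i 1) y) := by
  rw [killGreen, (summable_killProb hd N x y).tsum_eq_zero_add]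
  simp only [killProb, if_pos hx]
  rw [tsum_mul_left, Summable.tsum_finsetSum fun i _ =>
    (summable_killProb hd N _ y).add (summable_killProb hd N _ y)]
  congr 2
  refine Finset.sum_congr rfl fun i _ => ?_
  exact (summable_killProb hd N _ y).tsum_add (summable_killProb hd N _ y)

theorem green_eq_sum_add_greenTail (hd : 5 ≤ d) (K : ℕ) (x y : Site d) :
    green x y = ∑ n ∈ Finset.range K, walkProb n x y + greenTail K x y :=
  ((summable_walkProb hd x y).sum_add_tsum_nat_add K).symm

/-- A walk from Λ_R cannot have left Λ_N at any time n < K, since R + n ≤ N; the killed and free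
walks therefore differ only from time K on. -/
theorem green_sub_killGreen_le (hd : 5 ≤ d) {R K N : ℕ} {x : Site d} (hx : x ∈ box d R)
    (h : R + K ≤ N + 1) (y : Site d) : green x y - killGreen N x y ≤ greenTail K x y := by
  rw [green_eq_sum_add_greenTail hd K, sub_le_iff_le_add, add_comm]
  have : ∑ n ∈ Finset.range K, walkProb n x y = ∑ n ∈ Finset.range K, killProb N n x y :=
    Finset.sum_congr rfl fun n hn =>
      (killProb_eq_walkProb hx (by have := Finset.mem_range.1 hn; omega) y).symm
  rw [this]
  gcongr
  exact (summable_killProb hd N x y).sum_le_tsum _ fun n _ => killProb_nonneg _ _ _ _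

theorem green_eq_greenTail (hd : 5 ≤ d) {R K N : ℕ} {x y : Site d} (hx : x ∈ box d R)
    (h : R + K ≤ N + 1) (hy : y ∉ box d N) : green x y = greenTail K x y := by
  rw [green_eq_sum_add_greenTail hd K, Finset.sum_eq_zero, zero_add]
  intro n hn
  exact walkProb_eq_zero hx (by have := Finset.mem_range.1 hn; omega) hy

/-! ### The Dirichlet form -/

theorem finite_support_shift {f : Site d → ℝ} (hf : f.support.Finite) (e : Site d) :
    (Function.support fun z => f (z + e)).Finite :=
  (hf.preimage (add_left_injective e).injOn).subset fun _ hz => hz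

theorem memℓp_gradient {f : Site d → ℝ} (hf : f.support.Finite) :
    Memℓp (fun p : Fin d × Site d =>
      (√(2 * (d : ℝ)))⁻¹ * (f p.2 - f (p.2 + Pi.single p.1 1))) 2 := by
  refine memℓp_gen (summable_of_hasFiniteSupport ?_)
  refine (Set.finite_univ.prod (hf.union
    (Set.finite_iUnion fun i : Fin d => finite_support_shift hf (Pi.single i 1)))).subset ?_
  rintro ⟨i, z⟩ hz
  refine ⟨trivial, ?_⟩
  by_contra hcon
  simp only [Set.mem_union, Function.mem_support, Set.mem_iUnion, not_or, not_exists,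
    not_not] at hcon
  refine hz ?_
  simp [hcon.1, hcon.2 i]

/-- The gradient of a finitely supported function, normalised so that its squared norm is
`⟨f, -Δ f⟩`. -/
def gradVec (f : Site d → ℝ) (hf : f.support.Finite) : lp (fun _ : Fin d × Site d => ℝ) 2 :=
  ⟨_, memℓp_gradient hf⟩

theorem gradVec_apply (f : Site d → ℝ) (hf : f.support.Finite) (p : Fin d × Site d) :
    gradVec f hf p = (√(2 * (d : ℝ)))⁻¹ * (f p.2 - f (p.2 + Pi.single p.1 1)) := rfl

theorem inner_gradVec_eq_sum (f h : Site d → ℝ) (hf : f.support.Finite) (hh : h.support.Finite) :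
    inner ℝ (gradVec f hf) (gradVec h hh) = 1 / (2 * (d : ℝ)) *
      ∑ i : Fin d, ∑' z, (f z - f (z + Pi.single i 1)) * (h z - h (z + Pi.single i 1)) := by
  have hs := lp.summable_inner (𝕜 := ℝ) (gradVec f hf) (gradVec h hh)
  rw [lp.inner_eq_tsum, hs.tsum_prod, tsum_fintype, Finset.mul_sum]
  refine Finset.sum_congr rfl fun i _ => ?_
  rw [← tsum_mul_left]
  congr 1
  funext z
  rw [gradVec_apply, gradVec_apply]
  have : (√(2 * (d : ℝ)))⁻¹ * (√(2 * (d : ℝ)))⁻¹ = 1 / (2 * (d : ℝ)) := by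
    rw [← mul_inv, Real.mul_self_sqrt (by positivity), one_div]
  rw [← this]
  simp only [RCLike.inner_apply, conj_trivial]
  ring

/-- Summation by parts: ⟨∇f, ∇h⟩ = ⟨f, -Δh⟩. -/
theorem inner_gradVec (hd : 0 < d) (f h : Site d → ℝ) (hf : f.support.Finite)
    (hh : h.support.Finite) :
    inner ℝ (gradVec f hf) (gradVec h hh) = ∑' z, f z * (h z - 1 / (2 * (d : ℝ)) *
      ∑ i : Fin d, (h (z + Pi.single i 1) + h (z - Pi.single i 1))) := by
  have hd' : (d : ℝ) ≠ 0 := by exact_mod_cast hd.ne'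
  have hfs : ∀ g : Site d → ℝ, Summable fun z => f z * g z := fun g =>
    summable_of_hasFiniteSupport (hf.subset fun z hz => left_ne_zero_of_mul hz)
  have key : ∀ i : Fin d,
      ∑' z, (f z - f (z + Pi.single i 1)) * (h z - h (z + Pi.single i 1)) =
      ∑' z, f z * (2 * h z - (h (z + Pi.single i 1) + h (z - Pi.single i 1))) := by
    intro i
    have h1 : ∑' z, f z * (h (z - Pi.single i 1) - h z) =
        ∑' z, f (z + Pi.single i 1) * (h z - h (z + Pi.single i 1)) := by
      rw [← (Equiv.addRight (Pi.single i 1 : Site d)).tsum_eq]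
      simp
    have h2 : Summable fun z => f (z + Pi.single i 1) * (h z - h (z + Pi.single i 1)) :=
      summable_of_hasFiniteSupport ((finite_support_shift hf _).subset fun z hz =>
        left_ne_zero_of_mul hz)
    simp_rw [sub_mul]
    rw [(hfs _).tsum_sub h2, ← h1, ← (hfs _).tsum_sub (hfs _)]
    congr 1
    funext z
    ring
  rw [inner_gradVec_eq_sum]
  simp_rw [key]
  rw [← Summable.tsum_finsetSum fun i _ => hfs _, ← tsum_mul_left]
  congr 1
  funext z
  rw [← Finset.mul_sum, Finset.sum_sub_distrib]
  simp only [Finset.sum_const, Finset.card_univ, Fintype.card_fin, nsmul_eq_mul]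
  field_simp

theorem finite_support_killGreen (N : ℕ) (x : Site d) :
    (Function.support fun z => killGreen N z x).Finite :=
  (box d N).finite_toSet.subset fun _ hz => by
    by_contra h
    exact hz (killGreen_of_notMem_left h x)

theorem finite_support_extendZero (N : ℕ) (φ : box d N → ℝ) :
    (extendZero d N φ).support.Finite :=
  (box d N).finite_toSet.subset fun _ hz => by
    by_contra h
    exact hz (dif_neg h)

/-- The gradient of the finite volume Green function. -/
def greenVec (N : ℕ) (x : Site d) : lp (fun _ : Fin d × Site d => ℝ) 2 :=
  gradVec (fun z => killGreen N z x) (finite_support_killGreen N x)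

/-- Inside Λ_M the function G_M(·,y) satisfies -ΔG_M(·,y) = δ_y, and outside, where this fails, f
vanishes. -/
theorem inner_gradVec_greenVec (hd : 5 ≤ d) {f : Site d → ℝ} (hf : f.support.Finite) {M : ℕ}
    (hM : ∀ z ∉ box d M, f z = 0) (y : Site d) :
    inner ℝ (gradVec f hf) (greenVec M y) = f y := by
  rw [greenVec, inner_gradVec (by omega), tsum_eq_single y]
  · by_cases hy : y ∈ box d M
    · rw [killGreen_eq hd hy]
      simp
    · rw [hM y hy, zero_mul]
  · intro z hz
    by_cases hy : z ∈ box d M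
    · rw [killGreen_eq hd hy, if_neg hz]
      simp
    · rw [hM z hy, zero_mul]

theorem inner_greenVec (hd : 5 ≤ d) {N M : ℕ} (h : N ≤ M) (x y : Site d) :
    inner ℝ (greenVec N x) (greenVec M y) = killGreen N y x :=
  inner_gradVec_greenVec hd _ (fun _ hz => killGreen_of_notMem_left
    (fun hz' => hz (box_mono h hz')) x) y

/-- Symmetry of the inner product replaces path reversal. -/
theorem killGreen_comm (hd : 5 ≤ d) (N : ℕ) (x y : Site d) :
    killGreen N x y = killGreen N y x := by
  rw [← inner_greenVec hd le_rfl, real_inner_comm, inner_greenVec hd le_rfl]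

theorem tendsto_killGreen (hd : 5 ≤ d) (x y : Site d) :
    Tendsto (fun N => killGreen N x y) atTop (𝓝 (green x y)) := by
  obtain ⟨R, hR⟩ := exists_mem_box x
  have h1 : Tendsto (fun K => green x y - greenTail K x y) atTop (𝓝 (green x y - 0)) :=
    tendsto_const_nhds.sub (tendsto_sum_nat_add fun n => walkProb n x y)
  rw [sub_zero] at h1
  rw [← tendsto_add_atTop_iff_nat R]
  refine tendsto_of_tendsto_of_tendsto_of_le_of_le h1 tendsto_const_nhds (fun K => ?_)
    fun K => killGreen_le_green hd _ _ _
  have := green_sub_killGreen_le hd hR (K := K) (N := K + R) (by omega) y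
  simp only
  linarith

theorem norm_greenVec_sub_sq (hd : 5 ≤ d) {N M : ℕ} (h : N ≤ M) (x : Site d) :
    ‖greenVec M x - greenVec N x‖ ^ 2 = killGreen M x x - killGreen N x x := by
  rw [norm_sub_sq_real, real_inner_comm, inner_greenVec hd h, ← real_inner_self_eq_norm_sq,
    ← real_inner_self_eq_norm_sq, inner_greenVec hd le_rfl, inner_greenVec hd le_rfl]
  ring

theorem exists_tendsto_greenVec (hd : 5 ≤ d) (x : Site d) :
    ∃ v, Tendsto (fun N => greenVec N x) atTop (𝓝 v) := by
  refine cauchySeq_tendsto_of_complete ?_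
  have hb : Tendsto (fun N => 2 * √(green x x - killGreen N x x)) atTop (𝓝 0) := by
    have := ((tendsto_const_nhds (x := green x x)).sub (tendsto_killGreen hd x x)).sqrt.const_mul 2
    simpa using this
  have hle : ∀ n N, N ≤ n → dist (greenVec n x) (greenVec N x) ≤
      √(green x x - killGreen N x x) := fun n N h => by
    rw [dist_eq_norm]
    refine Real.le_sqrt_of_sq_le ?_
    rw [norm_greenVec_sub_sq hd h]
    exact sub_le_sub_right (killGreen_le_green hd _ _ _) _
  refine cauchySeq_of_le_tendsto_0 _ (fun n m N hn hm => ?_) hb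
  calc _ ≤ dist (greenVec n x) (greenVec N x) + dist (greenVec m x) (greenVec N x) :=
        dist_triangle_right _ _ _
    _ ≤ _ := by linarith [hle n N hn, hle m N hm]

theorem inner_eq_green_of_tendsto (hd : 5 ≤ d) {v : Site d → lp (fun _ : Fin d × Site d => ℝ) 2}
    (hv : ∀ x, Tendsto (fun N => greenVec N x) atTop (𝓝 (v x))) (x y : Site d) :
    inner ℝ (v x) (v y) = green x y := by
  refine tendsto_nhds_unique ((hv x).inner (hv y)) ?_
  simp_rw [inner_greenVec hd le_rfl, ← killGreen_comm hd _ x y]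
  exact tendsto_killGreen hd x y

/-! ### The Hamiltonian -/

theorem neighbor_iff {x y : Site d} :
    Neighbor x y ↔ ∃ i, y = x + Pi.single i 1 ∨ x = y + Pi.single i 1 := by
  constructor
  · intro h
    obtain ⟨i, hi⟩ : ∃ i, x i - y i ≠ 0 := by
      by_contra hcon
      push Not at hcon
      simp [Neighbor, hcon] at h
    have h1 : 1 ≤ |x i - y i| := Int.one_le_abs hi
    have h2 := Finset.add_sum_erase Finset.univ (fun j => |x j - y j|) (Finset.mem_univ i)
    rw [show ∑ j, |x j - y j| = 1 from h] at h2
    have h3 : 0 ≤ ∑ j ∈ Finset.univ.erase i, |x j - y j| :=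
      Finset.sum_nonneg fun j _ => abs_nonneg _
    have h4 : ∑ j ∈ Finset.univ.erase i, |x j - y j| = 0 := by
      linarith
    have h5 : |x i - y i| = 1 := by
      linarith
    have h6 : ∀ j, j ≠ i → x j = y j := fun j hj => by
      have := (Finset.sum_eq_zero_iff_of_nonneg fun j _ => abs_nonneg _).1 h4 j
        (Finset.mem_erase.2 ⟨hj, Finset.mem_univ j⟩)
      exact sub_eq_zero.1 (abs_eq_zero.1 this)
    refine ⟨i, ?_⟩
    rcases (abs_eq zero_le_one).1 h5 with h | h
    · right
      funext j
      by_cases hj : j = i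
      · subst hj
        simp only [Pi.add_apply, Pi.single_eq_same]
        omega
      · simp [Pi.single_eq_of_ne hj, h6 j hj]
    · left
      funext j
      by_cases hj : j = i
      · subst hj
        simp only [Pi.add_apply, Pi.single_eq_same]
        omega
      · simp [Pi.single_eq_of_ne hj, h6 j hj]
  · rintro ⟨i, rfl | rfl⟩
    · simp only [Neighbor, Pi.add_apply]
      rw [Finset.sum_eq_single i]
      · simp
      · intro j _ hj; simp [Pi.single_eq_of_ne hj]
      · simp
    · simp only [Neighbor, Pi.add_apply]
      rw [Finset.sum_eq_single i]
      · simp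
      · intro j _ hj; simp [Pi.single_eq_of_ne hj]
      · simp

theorem single_add_single_ne_zero (i j : Fin d) : (Pi.single i 1 + Pi.single j 1 : Site d) ≠ 0 := by
  intro h
  have := congrFun h i
  by_cases hij : i = j
  · subst hij; simp at this
  · simp [Pi.single_eq_of_ne hij] at this

theorem ite_neighbor_eq (x y : Site d) : (if Neighbor x y then (1 : ℝ) else 0) =
    ∑ i : Fin d, ((if y = x + Pi.single i 1 then (1 : ℝ) else 0) +
      (if x = y + Pi.single i 1 then (1 : ℝ) else 0)) := by
  have hinj : ∀ i j : Fin d, (Pi.single i 1 : Site d) = Pi.single j 1 ↔ i = j := fun i j => by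
    constructor
    · intro h
      by_contra hij
      have := congrFun h i
      simp [Pi.single_eq_of_ne hij] at this
    · rintro rfl; rfl
  split_ifs with h
  · obtain ⟨k, rfl | rfl⟩ := neighbor_iff.1 h
    · simp [add_assoc, single_add_single_ne_zero, hinj]
    · simp [add_assoc, single_add_single_ne_zero, hinj]
  · rw [Finset.sum_eq_zero]
    intro i _
    rw [if_neg fun h' => h (neighbor_iff.2 ⟨i, Or.inl h'⟩),
      if_neg fun h' => h (neighbor_iff.2 ⟨i, Or.inr h'⟩), add_zero]

/-- Edges that miss Λ_N contribute 0, so the sum may run over all edges of the lattice; the factor 2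
counts the two orientations. -/
theorem sum_bonds (N : ℕ) (F : Site d → ℝ) (hF : ∀ z ∉ box d N, F z = 0) :
    ∑ p ∈ bonds d N, (F p.1 - F p.2) ^ 2 =
      2 * ∑ i : Fin d, ∑' z, (F z - F (z + Pi.single i 1)) ^ 2 := by
  set B := box d (N + 1) with hBdef
  have h1 : ∑ p ∈ bonds d N, (F p.1 - F p.2) ^ 2 =
      ∑ x ∈ B, ∑ y ∈ B, (if Neighbor x y then (1 : ℝ) else 0) * (F x - F y) ^ 2 := by
    rw [bonds, Finset.sum_filter, Finset.sum_product]
    refine Finset.sum_congr rfl fun x _ => Finset.sum_congr rfl fun y _ => ?_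
    simp only
    by_cases hn : Neighbor x y
    · simp only [hn, true_and, if_true, one_mul, ite_eq_left_iff, not_or]
      rintro ⟨hx, hy⟩
      simp [hF x hx, hF y hy]
    · simp [hn]
  have h2 : ∀ i : Fin d, ∑ x ∈ B, ∑ y ∈ B,
      (if y = x + Pi.single i 1 then (1 : ℝ) else 0) * (F x - F y) ^ 2 =
      ∑' z, (F z - F (z + Pi.single i 1)) ^ 2 := by
    intro i
    rw [tsum_eq_sum (s := B)]
    · refine Finset.sum_congr rfl fun x _ => ?_
      simp only [ite_mul, one_mul, zero_mul, Finset.sum_ite_eq']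
      split_ifs with h
      · rfl
      · have hx : x ∉ box d N := fun hx => h (add_single_mem_box hx i)
        have hx' : x + Pi.single i 1 ∉ box d N := fun hx' => h (box_mono (by omega) hx')
        simp [hF _ hx, hF _ hx']
    · intro z hz
      have hx : z ∉ box d N := fun hx => hz (box_mono (by omega) hx)
      have hx' : z + Pi.single i 1 ∉ box d N := fun hx' => hz (by
        simpa using sub_single_mem_box hx' i)
      simp [hF _ hx, hF _ hx']
  have h3 : ∀ i : Fin d, ∑ x ∈ B, ∑ y ∈ B,
      (if x = y + Pi.single i 1 then (1 : ℝ) else 0) * (F x - F y) ^ 2 =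
      ∑' z, (F z - F (z + Pi.single i 1)) ^ 2 := by
    intro i
    rw [Finset.sum_comm, ← h2 i]
    refine Finset.sum_congr rfl fun x _ => Finset.sum_congr rfl fun y _ => ?_
    ring
  rw [h1]
  simp_rw [ite_neighbor_eq, Finset.sum_mul]
  have h4 : ∀ x, ∑ y ∈ B, ∑ i : Fin d, ((if y = x + Pi.single i 1 then (1 : ℝ) else 0) +
      (if x = y + Pi.single i 1 then (1 : ℝ) else 0)) * (F x - F y) ^ 2 =
      ∑ i : Fin d, ∑ y ∈ B, ((if y = x + Pi.single i 1 then (1 : ℝ) else 0) +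
      (if x = y + Pi.single i 1 then (1 : ℝ) else 0)) * (F x - F y) ^ 2 :=
    fun x => Finset.sum_comm
  simp_rw [h4]
  rw [Finset.sum_comm, Finset.mul_sum]
  refine Finset.sum_congr rfl fun i _ => ?_
  simp_rw [add_mul, Finset.sum_add_distrib]
  rw [h2, h3]
  ring

theorem hamiltonian_eq (N : ℕ) (φ : box d N → ℝ) :
    hamiltonian d N φ =
      1 / 2 * ‖gradVec (extendZero d N φ) (finite_support_extendZero N φ)‖ ^ 2 := by
  rw [hamiltonian, sum_bonds N (extendZero d N φ) fun z hz => dif_neg hz, ← real_inner_self_eq_norm_sq,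
    inner_gradVec_eq_sum]
  simp_rw [← sq]
  ring

end walk

/-! ### Almost sure convergence of weighted sums with monotone weights -/

/-- A dyadic chaining bound for the maximal increment of `x` on `[s, s + 2 ^ j]`. -/
def chainBound (x : ℕ → ℝ) : ℕ → ℕ → ℝ
  | 0, s => (x (s + 1) - x s) ^ 2
  | j + 1, s => ((j : ℝ) + 2) * (x (s + 2 ^ j) - x s) ^ 2 +
      ((j : ℝ) + 2) / ((j : ℝ) + 1) * (chainBound x j s + chainBound x j (s + 2 ^ j))

theorem chainBound_nonneg (x : ℕ → ℝ) (j s : ℕ) : 0 ≤ chainBound x j s := by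
  induction j generalizing s with
  | zero => exact sq_nonneg _
  | succ j ih => simp only [chainBound]; have := ih s; have := ih (s + 2 ^ j); positivity

/-- An increment ending in the second half of the block is split at the midpoint, and the recursion
pays for both halves at once. -/
theorem sq_sub_le_chainBound (x : ℕ → ℝ) (j s i : ℕ) (hi : i ≤ 2 ^ j) :
    (x (s + i) - x s) ^ 2 ≤ chainBound x j s := by
  induction j generalizing s i with
  | zero =>
    have : i = 0 ∨ i = 1 := by have : i ≤ 1 := by simpa using hi
                               omega
    rcases this with rfl | rfl
    · simpa [chainBound] using sq_nonneg _
    · simp [chainBound]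
  | succ j ih =>
    simp only [chainBound]
    have n1 := chainBound_nonneg x j s
    have n2 := chainBound_nonneg x j (s + 2 ^ j)
    have hj : (0 : ℝ) < (j : ℝ) + 1 := by positivity
    rcases le_total i (2 ^ j) with h | h
    · have h1 := ih s i h
      have h2 : 1 ≤ ((j : ℝ) + 2) / ((j : ℝ) + 1) := by
        rw [le_div_iff₀ hj]; linarith
      have h3 : 0 ≤ ((j : ℝ) + 2) * (x (s + 2 ^ j) - x s) ^ 2 := by positivity
      nlinarith
    · obtain ⟨k, rfl⟩ := Nat.exists_eq_add_of_le h
      have hk : k ≤ 2 ^ j := by rw [pow_succ] at hi; omega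
      have h1 := ih (s + 2 ^ j) k hk
      rw [← add_assoc]
      set A := x (s + 2 ^ j) - x s
      set B := x (s + 2 ^ j + k) - x (s + 2 ^ j)
      have hAB : x (s + 2 ^ j + k) - x s = A + B := by simp only [A, B]; ring
      -- This is (A + B)² ≤ (1 + p)A² + (1 + 1/p)B² with p = j + 1. The factors 1 + 1/p telescope
      -- over the levels, so the total cost is polynomial in j and not exponential.
      have h2 : (A + B) ^ 2 ≤ ((j : ℝ) + 2) * A ^ 2 + ((j : ℝ) + 2) / ((j : ℝ) + 1) * B ^ 2 := by
        have : ((j : ℝ) + 2) * A ^ 2 + ((j : ℝ) + 2) / ((j : ℝ) + 1) * B ^ 2 - (A + B) ^ 2 =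
            (((j : ℝ) + 1) * A - B) ^ 2 / ((j : ℝ) + 1) := by
          field_simp
          ring
        have h0 : 0 ≤ (((j : ℝ) + 1) * A - B) ^ 2 / ((j : ℝ) + 1) := by positivity
        linarith
      rw [hAB]
      refine h2.trans ?_
      gcongr
      linarith

theorem exists_tendsto_of_summable_chainBound (x : ℕ → ℝ)
    (h : Summable fun k : ℕ => ((k : ℝ) + 1) ^ 2 * chainBound x k (2 ^ k)) :
    ∃ l, Tendsto x atTop (𝓝 l) := by
  have hU : ∀ k i : ℕ, i ≤ 2 ^ k → |x (2 ^ k + i) - x (2 ^ k)| ≤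
      √(chainBound x k (2 ^ k)) := fun k i hi =>
    Real.abs_le_sqrt (sq_sub_le_chainBound x k (2 ^ k) i hi)
  have hinv : Summable fun k : ℕ => 1 / ((k : ℝ) + 1) ^ 2 := by
    have := (summable_nat_add_iff 1).2 (Real.summable_one_div_nat_pow.2 (by norm_num : 1 < 2))
    simpa using this
  have hsqrt : Summable fun k : ℕ => √(chainBound x k (2 ^ k)) := by
    refine (h.add hinv).of_nonneg_of_le (fun k => Real.sqrt_nonneg _) fun k => ?_
    have hk : (0 : ℝ) < (k : ℝ) + 1 := by positivity
    have hs := Real.sq_sqrt (chainBound_nonneg x k (2 ^ k))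
    set q := √(chainBound x k (2 ^ k))
    rw [← hs]
    have hq : 0 ≤ q := Real.sqrt_nonneg _
    -- The weight (k + 1)² in the hypothesis is what allows passing from summable squares to
    -- summable square roots.
    have h1 := two_mul_le_add_sq (((k : ℝ) + 1) * q) (1 / ((k : ℝ) + 1))
    have h2 : 2 * (((k : ℝ) + 1) * q) * (1 / ((k : ℝ) + 1)) = 2 * q := by field_simp
    rw [h2, mul_pow, one_div_pow] at h1
    linarith
  have hc : CauchySeq fun k : ℕ => x (2 ^ k) := by
    refine cauchySeq_of_summable_dist (hsqrt.of_nonneg_of_le (fun _ => dist_nonneg) fun k => ?_)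
    rw [dist_comm, Real.dist_eq]
    have := hU k (2 ^ k) le_rfl
    rwa [← two_mul, ← pow_succ'] at this
  obtain ⟨l, hl⟩ := cauchySeq_tendsto_of_complete hc
  refine ⟨l, ?_⟩
  -- Each N ≥ 1 lies in the dyadic block starting at 2^(log₂ N), whose oscillation tends to 0.
  have hlog : Tendsto (fun N : ℕ => Nat.log 2 N) atTop atTop :=
    tendsto_atTop.2 fun b => (eventually_ge_atTop (2 ^ b)).mono fun N hN =>
      Nat.le_log_of_pow_le (by norm_num) hN
  have h1 : Tendsto (fun N : ℕ => x (2 ^ Nat.log 2 N)) atTop (𝓝 l) := hl.comp hlog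
  have h2 : Tendsto (fun N : ℕ => x N - x (2 ^ Nat.log 2 N)) atTop (𝓝 0) := by
    refine squeeze_zero_norm' ?_ (hsqrt.tendsto_atTop_zero.comp hlog)
    filter_upwards [eventually_ge_atTop 1] with N hN
    have ha := Nat.pow_log_le_self 2 (by omega : N ≠ 0)
    have hb := Nat.lt_pow_succ_log_self (b := 2) (by norm_num) N
    rw [Nat.succ_eq_add_one, pow_succ] at hb
    have := hU (Nat.log 2 N) (N - 2 ^ Nat.log 2 N) (by omega)
    rwa [Nat.add_sub_cancel' ha] at this
  simpa using h2.add h1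

theorem ae_summable_of_summable_integral {Ω : Type*} [MeasurableSpace Ω] {P : Measure Ω}
    {f : ℕ → Ω → ℝ} (hf : ∀ k, Integrable (f k) P) (h0 : ∀ k ω, 0 ≤ f k ω)
    (hs : Summable fun k => ∫ ω, f k ω ∂P) : ∀ᵐ ω ∂P, Summable fun k => f k ω := by
  have h1 : ∫⁻ ω, ∑' k, ENNReal.ofReal (f k ω) ∂P ≠ ⊤ := by
    rw [lintegral_tsum fun k => (hf k).aestronglyMeasurable.aemeasurable.ennreal_ofReal]
    simp_rw [← fun k => ofReal_integral_eq_lintegral_ofReal (hf k) (Eventually.of_forall (h0 k))]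
    exact hs.tsum_ofReal_ne_top
  have h2 := ae_lt_top' (AEMeasurable.tsum fun k =>
    (hf k).aestronglyMeasurable.aemeasurable.ennreal_ofReal) h1
  filter_upwards [h2] with ω hω
  have := ENNReal.summable_toReal hω.ne
  simpa only [ENNReal.toReal_ofReal (h0 _ ω)] using this

section weights

variable {Ω ι : Type*} [MeasurableSpace Ω] {P : Measure Ω} {η : ι → Ω → ℝ} {σ2 : ℝ}

theorem memLp_sum_mul (hL2 : ∀ x, MemLp (η x) 2 P) (S : Finset ι) (c : ι → ℝ) :
    MemLp (fun ω => ∑ y ∈ S, c y * η y ω) 2 P :=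
  memLp_finsetSum _ fun y _ => (hL2 y).const_mul (c y)

theorem integral_sum_mul_sq (hL2 : ∀ x, MemLp (η x) 2 P)
    (hvar : ∀ x, ∫ ω, η x ω ^ 2 ∂P = σ2)
    (horth : ∀ x y, x ≠ y → ∫ ω, η x ω * η y ω ∂P = 0) (S : Finset ι) (c : ι → ℝ) :
    ∫ ω, (∑ y ∈ S, c y * η y ω) ^ 2 ∂P = σ2 * ∑ y ∈ S, c y ^ 2 := by
  classical
  have hint : ∀ x y, Integrable (fun ω => c x * η x ω * (c y * η y ω)) P := fun x y =>
    MemLp.integrable_mul ((hL2 x).const_mul (c x)) ((hL2 y).const_mul (c y))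
  simp_rw [sq, Finset.sum_mul_sum]
  rw [integral_finsetSum _ fun x _ => integrable_finsetSum _ fun y _ => hint x y, Finset.mul_sum]
  refine Finset.sum_congr rfl fun x hx => ?_
  rw [integral_finsetSum _ fun y _ => hint x y, Finset.sum_eq_single x]
  · rw [← hvar x, mul_comm (∫ ω, η x ω ^ 2 ∂P), ← integral_const_mul]
    congr 1
    funext ω
    ring
  · intro y _ hy
    have : (fun ω => c x * η x ω * (c y * η y ω)) = fun ω => c x * c y * (η x ω * η y ω) := by
      funext ω; ring
    rw [this, integral_const_mul, horth x y hy.symm, mul_zero]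
  · exact fun h => absurd hx h

/-- Orthogonality turns second moments into sums of squared weight increments, and monotonicity
makes these superadditive over adjacent blocks. The recursion then closes through (j + 2) + (j +
2)(j + 1) = (j + 2)². -/
theorem integral_chainBound_le (hL2 : ∀ x, MemLp (η x) 2 P)
    (hvar : ∀ x, ∫ ω, η x ω ^ 2 ∂P = σ2)
    (horth : ∀ x y, x ≠ y → ∫ ω, η x ω * η y ω ∂P = 0) (hσ : 0 ≤ σ2)
    {a : ℕ → ι → ℝ} (ha : Monotone a) (S : Finset ι) (j s : ℕ) :
    Integrable (fun ω => chainBound (fun N => ∑ y ∈ S, a N y * η y ω) j s) P ∧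
    ∫ ω, chainBound (fun N => ∑ y ∈ S, a N y * η y ω) j s ∂P ≤
      ((j : ℝ) + 1) ^ 2 * (σ2 * ∑ y ∈ S, (a (s + 2 ^ j) y - a s y) ^ 2) := by
  have hdiff : ∀ t u ω, (∑ y ∈ S, a t y * η y ω) - ∑ y ∈ S, a u y * η y ω =
      ∑ y ∈ S, (a t y - a u y) * η y ω := fun t u ω => by
    rw [← Finset.sum_sub_distrib]
    exact Finset.sum_congr rfl fun y _ => by ring
  have hint : ∀ t u, Integrable
      (fun ω => ((∑ y ∈ S, a t y * η y ω) - ∑ y ∈ S, a u y * η y ω) ^ 2) P := fun t u => by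
    simp_rw [hdiff]
    exact (memLp_sum_mul hL2 S fun y => a t y - a u y).integrable_sq
  have hval : ∀ t u, ∫ ω, ((∑ y ∈ S, a t y * η y ω) - ∑ y ∈ S, a u y * η y ω) ^ 2 ∂P =
      σ2 * ∑ y ∈ S, (a t y - a u y) ^ 2 := fun t u => by
    simp_rw [hdiff]
    exact integral_sum_mul_sq hL2 hvar horth S fun y => a t y - a u y
  induction j generalizing s with
  | zero =>
    simp only [chainBound]
    exact ⟨hint _ _, by rw [hval]; simp⟩
  | succ j ih =>
    simp only [chainBound]
    have i1 := (hint (s + 2 ^ j) s).const_mul ((j : ℝ) + 2)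
    have i2 := ((ih s).1.add (ih (s + 2 ^ j)).1).const_mul (((j : ℝ) + 2) / ((j : ℝ) + 1))
    refine ⟨i1.add i2, ?_⟩
    have e := integral_add i1 i2
    simp only [Pi.add_apply] at e
    rw [e, integral_const_mul, integral_const_mul, integral_add (ih s).1 (ih (s + 2 ^ j)).1, hval]
    have b1 := (ih s).2
    have b2 := (ih (s + 2 ^ j)).2
    have hs : s + 2 ^ j + 2 ^ j = s + 2 ^ (j + 1) := by rw [pow_succ]; ring
    rw [hs] at b2
    have hp := Nat.two_pow_pos j
    have m1 : ∀ y, a s y ≤ a (s + 2 ^ j) y := fun y => ha (by omega) y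
    have m2 : ∀ y, a (s + 2 ^ j) y ≤ a (s + 2 ^ (j + 1)) y := fun y => ha (by omega) y
    have c1 : ∑ y ∈ S, (a (s + 2 ^ j) y - a s y) ^ 2 +
        ∑ y ∈ S, (a (s + 2 ^ (j + 1)) y - a (s + 2 ^ j) y) ^ 2 ≤
        ∑ y ∈ S, (a (s + 2 ^ (j + 1)) y - a s y) ^ 2 := by
      rw [← Finset.sum_add_distrib]
      refine Finset.sum_le_sum fun y _ => ?_
      -- For p ≤ q ≤ r one has (q - p)² + (r - q)² ≤ (r - p)².
      nlinarith [m1 y, m2 y]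
    set A := ∑ y ∈ S, (a (s + 2 ^ j) y - a s y) ^ 2
    set B := ∑ y ∈ S, (a (s + 2 ^ (j + 1)) y - a (s + 2 ^ j) y) ^ 2
    set D := ∑ y ∈ S, (a (s + 2 ^ (j + 1)) y - a s y) ^ 2
    have hA : 0 ≤ A := Finset.sum_nonneg fun y _ => sq_nonneg _
    have hB : 0 ≤ B := Finset.sum_nonneg fun y _ => sq_nonneg _
    have hj : (0 : ℝ) < (j : ℝ) + 1 := by positivity
    calc _ ≤ ((j : ℝ) + 2) * (σ2 * D) + ((j : ℝ) + 2) / ((j : ℝ) + 1) *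
          (((j : ℝ) + 1) ^ 2 * (σ2 * A) + ((j : ℝ) + 1) ^ 2 * (σ2 * B)) := by
          gcongr
          linarith
      _ = ((j : ℝ) + 2) * (σ2 * D) + ((j : ℝ) + 2) * ((j : ℝ) + 1) * (σ2 * (A + B)) := by
          field_simp
      _ ≤ ((j : ℝ) + 2) * (σ2 * D) + ((j : ℝ) + 2) * ((j : ℝ) + 1) * (σ2 * D) := by gcongr
      _ = _ := by push_cast; ring

theorem summable_add_one_pow_mul_geometric (m : ℕ) {q : ℝ} (h0 : 0 < q) (h1 : q < 1) :
    Summable fun k : ℕ => ((k : ℝ) + 1) ^ m * q ^ k := by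
  have hq : ‖q‖ < 1 := by rwa [Real.norm_of_nonneg h0.le]
  have h : Summable fun n : ℕ => (n : ℝ) ^ m * q ^ n :=
    summable_pow_mul_geometric_of_norm_lt_one m hq
  have h' : Summable fun n : ℕ => ((n + 1 : ℕ) : ℝ) ^ m * q ^ (n + 1) :=
    (summable_nat_add_iff (f := fun n : ℕ => (n : ℝ) ^ m * q ^ n) 1).2 h
  refine (h'.mul_left q⁻¹).congr fun k => ?_
  push_cast
  rw [pow_succ q k]
  field_simp

theorem summable_pow_mul_two_pow_rpow (m : ℕ) :
    Summable fun k : ℕ => ((k : ℝ) + 1) ^ m * (1 / (((2 ^ k : ℕ) : ℝ) + 1) ^ (1 / 4 : ℝ)) := by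
  refine (summable_add_one_pow_mul_geometric m (q := (1 / 2 : ℝ) ^ (1 / 4 : ℝ)) (by positivity)
    (Real.rpow_lt_one (by norm_num) (by norm_num) (by norm_num))).of_nonneg_of_le
    (fun k => by positivity) fun k => mul_le_mul_of_nonneg_left ?_ (by positivity)
  have e : ((1 / 2 : ℝ) ^ (1 / 4 : ℝ)) ^ k = 1 / ((2 : ℝ) ^ k) ^ (1 / 4 : ℝ) := by
    rw [← Real.rpow_natCast, ← Real.rpow_mul (by norm_num), mul_comm, Real.rpow_mul (by norm_num),
      Real.rpow_natCast, one_div_pow, Real.div_rpow (by norm_num) (by positivity), Real.one_rpow]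
  rw [e]
  push_cast
  gcongr
  linarith

theorem ae_exists_tendsto_of_monotone (hL2 : ∀ x, MemLp (η x) 2 P)
    (hvar : ∀ x, ∫ ω, η x ω ^ 2 ∂P = σ2)
    (horth : ∀ x y, x ≠ y → ∫ ω, η x ω * η y ω ∂P = 0) (hσ : 0 ≤ σ2)
    {a : ℕ → ι → ℝ} (ha : Monotone a) {B : ℕ → Finset ι} (hB : Monotone B)
    (hsupp : ∀ N, ∀ y ∉ B N, a N y = 0) {C : ℝ}
    (hC : ∀ N M, N ≤ M → ∀ S : Finset ι,
      ∑ y ∈ S, (a M y - a N y) ^ 2 ≤ C * (1 / ((N : ℝ) + 1) ^ (1 / 4 : ℝ))) :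
    ∀ᵐ ω ∂P, ∃ l, Tendsto (fun N => ∑ y ∈ B N, a N y * η y ω) atTop (𝓝 l) := by
  have hX : ∀ {N M : ℕ}, N ≤ M → ∀ ω, ∑ y ∈ B N, a N y * η y ω = ∑ y ∈ B M, a N y * η y ω :=
    fun {N M} h ω => Finset.sum_subset (hB h) fun y _ hy => by rw [hsupp N y hy, zero_mul]
  -- The chaining bound on a block sees only times up to its end, so the growing index sets can be
  -- replaced by the last one; the extra weights are zero.
  have hloc : ∀ (x x' : ℕ → ℝ) (j s : ℕ), (∀ t ≤ s + 2 ^ j, x t = x' t) →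
      chainBound x j s = chainBound x' j s := by
    intro x x' j
    induction j with
    | zero =>
      intro s h
      simp only [chainBound]
      rw [h (s + 1) (by simp), h s (by simp)]
    | succ j ih =>
      intro s h
      have hp : 2 ^ (j + 1) = 2 ^ j + 2 ^ j := by rw [pow_succ]; ring
      have hp' := Nat.two_pow_pos j
      simp only [chainBound]
      rw [h (s + 2 ^ j) (by omega), h s (by omega), ih s fun t ht => h t (by omega),
        ih (s + 2 ^ j) fun t ht => h t (by omega)]
  have hb : ∀ k : ℕ,
      Integrable (fun ω => chainBound (fun N => ∑ y ∈ B N, a N y * η y ω) k (2 ^ k)) P ∧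
      ∫ ω, chainBound (fun N => ∑ y ∈ B N, a N y * η y ω) k (2 ^ k) ∂P ≤
        ((k : ℝ) + 1) ^ 2 * (σ2 * (C * (1 / (((2 ^ k : ℕ) : ℝ) + 1) ^ (1 / 4 : ℝ)))) := by
    intro k
    have e : (fun ω => chainBound (fun N => ∑ y ∈ B N, a N y * η y ω) k (2 ^ k)) = fun ω =>
        chainBound (fun N => ∑ y ∈ B (2 ^ k + 2 ^ k), a N y * η y ω) k (2 ^ k) := by
      funext ω
      exact hloc _ _ _ _ fun t ht => hX ht ω
    rw [e]
    have := integral_chainBound_le hL2 hvar horth hσ ha (B (2 ^ k + 2 ^ k)) k (2 ^ k)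
    refine ⟨this.1, this.2.trans ?_⟩
    gcongr
    exact hC _ _ (Nat.le_add_right _ _) _
  have hs : ∀ᵐ ω ∂P, Summable fun k : ℕ =>
      ((k : ℝ) + 1) ^ 2 * chainBound (fun N => ∑ y ∈ B N, a N y * η y ω) k (2 ^ k) := by
    refine ae_summable_of_summable_integral (fun k => (hb k).1.const_mul _)
      (fun k ω => mul_nonneg (by positivity) (chainBound_nonneg _ _ _)) ?_
    -- The power 4 combines the (k + 1)² from chaining with the (k + 1)² required for summable
    -- square roots.
    refine ((summable_pow_mul_two_pow_rpow 4).mul_left (σ2 * C)).of_nonneg_of_le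
      (fun k => integral_nonneg fun ω =>
        mul_nonneg (by positivity) (chainBound_nonneg _ _ _)) fun k => ?_
    rw [integral_const_mul]
    calc _ ≤ ((k : ℝ) + 1) ^ 2 * _ := mul_le_mul_of_nonneg_left (hb k).2 (by positivity)
      _ = _ := by ring
  filter_upwards [hs] with ω hω
  exact exists_tendsto_of_summable_chainBound _ hω

/-- Along powers of two the rate N^(-1/4) is geometric, so the second moments are summable. -/
theorem ae_tendsto_zero_two_pow (hL2 : ∀ x, MemLp (η x) 2 P)
    (hvar : ∀ x, ∫ ω, η x ω ^ 2 ∂P = σ2)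
    (horth : ∀ x y, x ≠ y → ∫ ω, η x ω * η y ω ∂P = 0) (hσ : 0 ≤ σ2)
    {c : ℕ → ι → ℝ} {B : ℕ → Finset ι} {C : ℝ}
    (hC : ∀ N, ∑ y ∈ B N, c N y ^ 2 ≤ C * (1 / ((N : ℝ) + 1) ^ (1 / 4 : ℝ))) :
    ∀ᵐ ω ∂P, Tendsto (fun k : ℕ => ∑ y ∈ B (2 ^ k), c (2 ^ k) y * η y ω) atTop (𝓝 0) := by
  have hs : ∀ᵐ ω ∂P, Summable fun k : ℕ => (∑ y ∈ B (2 ^ k), c (2 ^ k) y * η y ω) ^ 2 := by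
    refine ae_summable_of_summable_integral
      (fun k => (memLp_sum_mul hL2 _ _).integrable_sq) (fun k ω => sq_nonneg _) ?_
    refine ((summable_pow_mul_two_pow_rpow 0).mul_left (σ2 * C)).of_nonneg_of_le
      (fun k => integral_nonneg fun ω => sq_nonneg _) fun k => ?_
    rw [integral_sum_mul_sq hL2 hvar horth]
    have := mul_le_mul_of_nonneg_left (hC (2 ^ k)) hσ
    rw [pow_zero, one_mul, mul_assoc]
    exact this
  filter_upwards [hs] with ω hω
  have := hω.tendsto_atTop_zero
  exact (tendsto_zero_iff_abs_tendsto_zero _).2 (by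
    have h := this.sqrt
    simpa [Real.sqrt_sq_eq_abs, Function.comp_def] using h)

end weights

/-! ### Isonormal Gaussian processes -/

/-- `W` sends every vector to a centred Gaussian variable with variance the squared norm. -/
def IsIsonormal {H Ω : Type*} [NormedAddCommGroup H] [InnerProductSpace ℝ H] [MeasurableSpace Ω]
    {P : Measure Ω} (W : H →ₗᵢ[ℝ] Lp ℝ 2 P) : Prop :=
  ∀ v, P.map (W v) = gaussianReal 0 (‖v‖ ^ 2).toNNReal

theorem map_sum_mul_gaussian {ι Ω : Type*} [MeasurableSpace Ω] {P : Measure Ω}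
    {ξ : ι → Ω → ℝ} (hlaw : ∀ i, HasLaw (ξ i) (gaussianReal 0 1) P)
    (hind : iIndepFun ξ P) (s : Finset ι) (c : ι → ℝ) :
    P.map (fun ω => ∑ i ∈ s, c i * ξ i ω) = gaussianReal 0 (∑ i ∈ s, c i ^ 2).toNNReal := by
  have hP := hind.isProbabilityMeasure
  have hL2 : ∀ i, MemLp (ξ i) 2 P := fun i => (hlaw i).hasGaussianLaw.memLp_two
  have hmean : ∀ i, ∫ ω, ξ i ω ∂P = 0 := fun i => by
    rw [(hlaw i).integral_eq]; exact integral_id_gaussianReal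
  have hvar : ∀ i, ∫ ω, ξ i ω ^ 2 ∂P = 1 := fun i => by
    have h1 : Var[ξ i; P] = 1 := by
      rw [(hlaw i).variance_eq]; simp
    rwa [variance_of_integral_eq_zero (hL2 i).aemeasurable (hmean i)] at h1
  have horth : ∀ i j, i ≠ j → ∫ ω, ξ i ω * ξ j ω ∂P = 0 := fun i j hij => by
    have := (hind.indepFun hij).integral_mul_eq_mul_integral (hL2 i).aestronglyMeasurable
      (hL2 j).aestronglyMeasurable
    simp only [Pi.mul_apply] at this
    rw [this, hmean i, zero_mul]
  have hind' : iIndepFun (fun (i : s) ω => c i * ξ i ω) P :=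
    (hind.precomp Subtype.val_injective).comp (fun (i : s) (x : ℝ) => c i * x)
      fun i => measurable_id.const_mul (c i)
  have hg : HasGaussianLaw (fun ω => ∑ i ∈ s, c i * ξ i ω) P := by
    have := iIndepFun.hasGaussianLaw_fun_sum (X := fun (i : s) ω => c i * ξ i ω) (P := P)
      (fun i => (hlaw i).hasGaussianLaw.fun_smul (c i)) hind'
    refine this.congr (Eventually.of_forall fun ω => ?_)
    exact Finset.sum_coe_sort s fun i => c i * ξ i ω
  have hm : ∫ ω, ∑ i ∈ s, c i * ξ i ω ∂P = 0 := by
    rw [integral_finsetSum _ fun i _ => ((hL2 i).integrable one_le_two).const_mul _]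
    exact Finset.sum_eq_zero fun i _ => by rw [integral_const_mul, hmean, mul_zero]
  rw [hg.map_eq_gaussianReal, variance_of_integral_eq_zero hg.aemeasurable hm, hm,
    integral_sum_mul_sq hL2 hvar horth, one_mul]

/-- L² convergence implies convergence in law, and the characteristic functions identify the limit.
A general countably generated filter covers the unconditional sums over finsets in
`exists_isonormal`. -/
theorem map_eq_gaussianReal_of_tendsto {Ω : Type*} [MeasurableSpace Ω] {P : Measure Ω}
    [IsProbabilityMeasure P] {ι : Type*} {l : Filter ι} [l.IsCountablyGenerated] [l.NeBot]
    {f : ι → Lp ℝ 2 P} {g : Lp ℝ 2 P} (hfg : Tendsto f l (𝓝 g)) {v : ι → ℝ} {v' : ℝ}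
    (h0 : ∀ i, 0 ≤ v i) (hv : Tendsto v l (𝓝 v'))
    (hf : ∀ i, P.map (f i) = gaussianReal 0 (v i).toNNReal) :
    P.map g = gaussianReal 0 v'.toNNReal := by
  have h0' : 0 ≤ v' := ge_of_tendsto' hv h0
  obtain ⟨u, hu⟩ := exists_seq_tendsto l
  have hd := (tendstoInMeasure_of_tendsto_Lp (hfg.comp hu)).tendstoInDistribution
    fun i => (Lp.aestronglyMeasurable (f (u i))).aemeasurable
  have hc := ProbabilityMeasure.tendsto_iff_tendsto_charFun.1 hd.tendsto
  have : IsProbabilityMeasure (P.map g) :=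
    Measure.isProbabilityMeasure_map (Lp.aestronglyMeasurable g).aemeasurable
  refine Measure.ext_of_charFun (funext fun t => ?_)
  refine tendsto_nhds_unique (hc t) ?_
  simp only [ProbabilityMeasure.coe_mk, Function.comp_apply, hf, charFun_gaussianReal]
  refine (Complex.continuous_exp.tendsto _).comp ?_
  refine tendsto_const_nhds.sub (Tendsto.div_const (Tendsto.mul_const _ ?_) _)
  simp only [Real.coe_toNNReal _ (h0 _), Real.coe_toNNReal _ h0']
  exact (Complex.continuous_ofReal.tendsto _).comp (hv.comp hu)

/-- Take W(v) = Σ v_i ξ_i with ξ_i independent standard Gaussians, which form an orthonormal family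
in L². -/
theorem exists_isonormal (ι : Type) [Countable ι] :
    ∃ (Ω : Type) (_ : MeasurableSpace Ω) (P : Measure Ω) (_ : IsProbabilityMeasure P)
      (W : lp (fun _ : ι => ℝ) 2 →ₗᵢ[ℝ] Lp ℝ 2 P), IsIsonormal W := by
  classical
  obtain ⟨Ω, mΩ, P, ξ, hmeas, hlaw, hind, hP⟩ := exists_iid ι (gaussianReal 0 1)
  have hL2 : ∀ i, MemLp (ξ i) 2 P := fun i => (hlaw i).hasGaussianLaw.memLp_two
  have hsum : ∀ (s : Finset ι) (c : ι → ℝ),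
      (∑ i ∈ s, c i • (hL2 i).toLp (ξ i) : Lp ℝ 2 P) =ᵐ[P] fun ω => ∑ i ∈ s, c i * ξ i ω := by
    intro s c
    refine (Lp.coeFn_finsetSum _ _).trans ?_
    have : ∀ᵐ ω ∂P, ∀ i ∈ s, (c i • (hL2 i).toLp (ξ i) : Lp ℝ 2 P) ω = c i * ξ i ω := by
      rw [eventually_all_finset]
      intro i _
      filter_upwards [Lp.coeFn_smul (c i) ((hL2 i).toLp (ξ i)), (hL2 i).coeFn_toLp] with ω h1 h2
      rw [h1, Pi.smul_apply, h2, smul_eq_mul]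
    filter_upwards [this] with ω hω
    rw [Finset.sum_apply]
    exact Finset.sum_congr rfl hω
  have hmap : ∀ (s : Finset ι) (c : ι → ℝ),
      P.map (∑ i ∈ s, c i • (hL2 i).toLp (ξ i) : Lp ℝ 2 P) =
        gaussianReal 0 (∑ i ∈ s, c i ^ 2).toNNReal := fun s c => by
    rw [Measure.map_congr (hsum s c), map_sum_mul_gaussian hlaw hind]
  have hortho : Orthonormal ℝ fun i => (hL2 i).toLp (ξ i) := by
    have hmean : ∀ i, ∫ ω, ξ i ω ∂P = 0 := fun i => by
      rw [(hlaw i).integral_eq]; exact integral_id_gaussianReal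
    have hin : ∀ i j, inner ℝ ((hL2 i).toLp (ξ i)) ((hL2 j).toLp (ξ j)) =
        ∫ ω, ξ i ω * ξ j ω ∂P := fun i j => by
      rw [L2.inner_def]
      refine integral_congr_ae ?_
      filter_upwards [(hL2 i).coeFn_toLp, (hL2 j).coeFn_toLp] with ω h1 h2
      rw [h1, h2, real_inner_comm]
      rfl
    rw [orthonormal_iff_ite]
    intro i j
    rw [hin]
    split_ifs with h
    · subst h
      have h1 : Var[ξ i; P] = 1 := by
        rw [(hlaw i).variance_eq]; simp
      rw [variance_of_integral_eq_zero (hL2 i).aemeasurable (hmean i)] at h1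
      simpa only [sq] using h1
    · have := (hind.indepFun h).integral_mul_eq_mul_integral (hL2 i).aestronglyMeasurable
        (hL2 j).aestronglyMeasurable
      simp only [Pi.mul_apply] at this
      rw [this, hmean i, zero_mul]
  have hV := hortho.orthogonalFamily
  refine ⟨Ω, mΩ, P, hP, hV.linearIsometry, fun v => ?_⟩
  have h1 := hV.hasSum_linearIsometry v
  have h2 : HasSum (fun i => v i ^ 2) (‖v‖ ^ 2) := by
    have := lp.hasSum_norm (p := 2) (by norm_num) v
    simpa using this
  refine map_eq_gaussianReal_of_tendsto h1 (fun s => Finset.sum_nonneg fun i _ => sq_nonneg (v i))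
    h2 fun s => ?_
  simpa using hmap s v

/-! ### Gaussian fields driven by an isonormal process -/

section field

variable {H Ω : Type*} [NormedAddCommGroup H] [InnerProductSpace ℝ H] [MeasurableSpace Ω]
    {P : Measure Ω} {W : H →ₗᵢ[ℝ] Lp ℝ 2 P}

/-- The field with mean `m` and fluctuations `W (v x)`. -/
def field {κ : Type*} (W : H →ₗᵢ[ℝ] Lp ℝ 2 P) (m : κ → ℝ) (v : κ → H) (ω : Ω) (x : κ) : ℝ :=
  m x + W (v x) ω

theorem measurable_field {κ : Type*} (m : κ → ℝ) (v : κ → H) : Measurable (field W m v) :=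
  measurable_pi_lambda _ fun _ => (Lp.stronglyMeasurable _).measurable.const_add _

theorem map_sum_mul_field (hW : IsIsonormal W) {κ : Type*} [Fintype κ] (m : κ → ℝ) (v : κ → H)
    (t : κ → ℝ) : P.map (fun ω => ∑ x, t x * field W m v ω x) =
      gaussianReal (∑ x, t x * m x) (‖∑ x, t x • v x‖ ^ 2).toNNReal := by
  have h : (fun ω => ∑ x, t x * field W m v ω x) =ᵐ[P]
      fun ω => ∑ x, t x * m x + W (∑ x, t x • v x) ω := by
    have h1 : ∀ᵐ ω ∂P, ∀ x, (t x • W (v x) : Lp ℝ 2 P) ω = t x * W (v x) ω := by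
      rw [ae_all_iff]
      intro x
      filter_upwards [Lp.coeFn_smul (t x) (W (v x))] with ω hω
      rw [hω, Pi.smul_apply, smul_eq_mul]
    rw [map_sum]
    simp_rw [map_smul]
    filter_upwards [h1, Lp.coeFn_finsetSum Finset.univ fun x => t x • W (v x)] with ω h1 h2
    rw [h2, Finset.sum_apply, ← Finset.sum_add_distrib]
    refine Finset.sum_congr rfl fun x _ => ?_
    rw [h1, field, mul_add]
  rw [Measure.map_congr h]
  have h2 : (fun ω => ∑ x, t x * m x + W (∑ x, t x • v x) ω) =
      (fun r => ∑ x, t x * m x + r) ∘ W (∑ x, t x • v x) := rfl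
  rw [h2, ← Measure.map_map (by fun_prop) (Lp.stronglyMeasurable _).measurable, hW,
    gaussianReal_map_const_add, zero_add]

theorem memLp_apply (v : H) : MemLp (W v) 2 P := Lp.memLp _

theorem integral_apply_eq_zero (hW : IsIsonormal W) (v : H) : ∫ ω, W v ω ∂P = 0 := by
  have := integral_map (μ := P) (φ := W v) (Lp.aestronglyMeasurable _).aemeasurable
    (f := fun x : ℝ => x) (by fun_prop)
  rw [← this, hW, integral_id_gaussianReal]

theorem isGaussianField_map_field [IsProbabilityMeasure P] {d : ℕ} (hW : IsIsonormal W) (m : Site d → ℝ) (v : Site d → H) :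
    IsGaussianField (P.map (field W m v)) m fun x y => inner ℝ (v x) (v y) where
  gaussian := by
    refine ⟨fun I => ⟨?_⟩⟩
    rw [Measure.map_map (by fun_prop) (measurable_field m v)]
    refine isGaussian_of_map_eq_gaussianReal fun L => ?_
    rw [Measure.map_map (by fun_prop) (Measurable.comp (by fun_prop) (measurable_field m v))]
    refine ⟨_, _, Eq.trans (congrArg P.map (funext fun ω => ?_)) (map_sum_mul_field hW
      (fun x : I => m x) (fun x : I => v x) fun x => L fun j => if x = j then 1 else 0)⟩
    refine (LinearMap.pi_apply_eq_sum_univ L.toLinearMap _).trans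
      (Finset.sum_congr rfl fun x _ => ?_)
    rw [smul_eq_mul, mul_comm]
    rfl
  mean_eq x := by
    rw [integral_map (measurable_field m v).aemeasurable
      (measurable_pi_apply x).aestronglyMeasurable]
    simp only [field]
    rw [integral_add (integrable_const _) ((memLp_apply _).integrable one_le_two),
      integral_apply_eq_zero hW]
    simp
  cov_eq x y := by
    rw [covariance_map (measurable_pi_apply x).aestronglyMeasurable
      (measurable_pi_apply y).aestronglyMeasurable (measurable_field m v).aemeasurable]
    have e : ∀ z, (fun φ : Site d → ℝ => φ z) ∘ field W m v = fun ω => m z + W (v z) ω :=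
      fun z => rfl
    rw [e, e, covariance_const_add_left ((memLp_apply _).integrable one_le_two),
      covariance_const_add_right ((memLp_apply _).integrable one_le_two),
      covariance_eq_sub (memLp_apply _) (memLp_apply _), integral_apply_eq_zero hW, zero_mul,
      sub_zero, ← W.inner_map_map, L2.inner_def]
    refine integral_congr_ae (Eventually.of_forall fun ω => ?_)
    simp [mul_comm]

/-- All fields live on one space, so it suffices that each subsequence has a further one converging
almost surely at every site. -/
theorem tendsto_map_field [IsProbabilityMeasure P] {d : ℕ} {m : Site d → ℝ} {v : Site d → H}
    {mN : ℕ → Site d → ℝ} {vN : ℕ → Site d → H} (hm : ∀ x, Tendsto (fun N => mN N x) atTop (𝓝 (m x)))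
    (hv : ∀ x, Tendsto (fun N => vN N x) atTop (𝓝 (v x))) :
    Tendsto (β := ProbabilityMeasure (Site d → ℝ))
      (fun N => ⟨P.map (field W (mN N) (vN N)),
        Measure.isProbabilityMeasure_map (measurable_field _ _).aemeasurable⟩) atTop
      (𝓝 ⟨P.map (field W m v),
        Measure.isProbabilityMeasure_map (measurable_field _ _).aemeasurable⟩) := by
  refine Filter.tendsto_of_subseq_tendsto fun ns hns => ?_
  -- Diagonal extraction: the k-th error is at most 2^(-k) simultaneously on Λ_k. A fixed site lies
  -- in Λ_k for all large k, so its squared errors are summable.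
  have hev : ∀ k : ℕ, ∀ᶠ j in atTop, ∀ x ∈ box d k, ‖vN (ns j) x - v x‖ ^ 2 ≤ (1 / 2 : ℝ) ^ k := by
    intro k
    rw [eventually_all_finset]
    intro x _
    have h1 : Tendsto (fun j => ‖vN (ns j) x - v x‖ ^ 2) atTop (𝓝 0) := by
      have := (((hv x).comp hns).sub_const (v x)).norm.pow 2
      simpa using this
    exact h1.eventually_le_const (by positivity)
  obtain ⟨ms, hms, hb⟩ := extraction_forall_of_eventually hev
  refine ⟨ms, ?_⟩
  have hae : ∀ᵐ ω ∂P, ∀ x, Tendsto (fun k => W (vN (ns (ms k)) x) ω) atTop (𝓝 (W (v x) ω)) := by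
    rw [ae_all_iff]
    intro x
    obtain ⟨R, hR⟩ := exists_mem_box x
    have hdiff : ∀ᵐ ω ∂P, ∀ k, W (vN (ns (ms k)) x - v x) ω =
        W (vN (ns (ms k)) x) ω - W (v x) ω := by
      rw [ae_all_iff]
      intro k
      rw [map_sub]
      exact Lp.coeFn_sub _ _
    have hs : ∀ᵐ ω ∂P, Summable fun k => W (vN (ns (ms k)) x - v x) ω ^ 2 := by
      refine ae_summable_of_summable_integral (fun k => (memLp_apply _).integrable_sq)
        (fun _ _ => sq_nonneg _) ?_
      have hval : ∀ u : H, ∫ ω, W u ω ^ 2 ∂P = ‖u‖ ^ 2 := fun u => by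
        rw [← W.norm_map, ← real_inner_self_eq_norm_sq, L2.inner_def]
        refine integral_congr_ae (Eventually.of_forall fun ω => ?_)
        simp [sq]
      simp_rw [hval]
      refine (summable_nat_add_iff R).1 ?_
      refine ((summable_nat_add_iff R).2 summable_geometric_two).of_nonneg_of_le
        (fun _ => sq_nonneg _) fun k => hb (k + R) x (box_mono (by omega) hR)
    filter_upwards [hdiff, hs] with ω h1 h2
    have h3 : Tendsto (fun k => W (vN (ns (ms k)) x - v x) ω) atTop (𝓝 0) :=
      (tendsto_zero_iff_abs_tendsto_zero _).2 (by
        have h := h2.tendsto_atTop_zero.sqrt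
        simpa [Real.sqrt_sq_eq_abs, Function.comp_def] using h)
    simp_rw [h1] at h3
    simpa using h3.add_const (W (v x) ω)
  have := tendstoInDistribution_of_ae_tendsto (μ' := P) (l := atTop)
    (X := fun k => field W (mN (ns (ms k))) (vN (ns (ms k)))) (Z := field W m v)
    (fun k => (measurable_field _ _).aemeasurable) (measurable_field _ _).aemeasurable (by
      filter_upwards [hae] with ω hω
      rw [tendsto_pi_nhds]
      exact fun x => (((hm x).comp hns).comp hms.tendsto_atTop).add (hω x))
  exact this.tendsto

end field

section gibbs

variable {d : ℕ}

/-! ### The law of the finite volume Gibbs measure -/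

theorem map_eq_gaussianReal_of_mgf {Ω : Type*} [MeasurableSpace Ω] {μ : Measure Ω}
    [IsProbabilityMeasure μ] {X : Ω → ℝ} (hX : AEMeasurable X μ) {m : ℝ} {v : NNReal}
    (h : ∀ s, mgf X μ s = Real.exp (m * s + v * s ^ 2 / 2)) : μ.map X = gaussianReal m v := by
  have h' : mgf X μ = mgf id (gaussianReal m v) := by
    rw [mgf_id_gaussianReal]
    exact funext h
  have huniv : integrableExpSet X μ = Set.univ := by
    refine Set.eq_univ_of_forall fun s => ?_
    -- Without integrability the moment generating function would take the default value 0,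
    -- contradicting positivity.
    refine mgf_pos_iff.1 ?_
    rw [h]
    exact Real.exp_pos _
  have hc : complexMGF X μ = complexMGF id (gaussianReal m v) := by
    funext z
    refine eqOn_complexMGF_of_mgf h' ?_
    simp [huniv]
  simpa using Measure.ext_of_complexMGF_eq hX aemeasurable_id hc

theorem extendZero_coe (N : ℕ) (φ : box d N → ℝ) (x : box d N) : extendZero d N φ x = φ x := by
  rw [extendZero, dif_pos x.2]

/-- The gradient of a configuration on `Λ_N`. -/
def configVec (N : ℕ) (φ : box d N → ℝ) : lp (fun _ : Fin d × Site d => ℝ) 2 :=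
  gradVec (extendZero d N φ) (finite_support_extendZero N φ)

theorem configVec_add (N : ℕ) (φ ψ : box d N → ℝ) :
    configVec N (φ + ψ) = configVec N φ + configVec N ψ := by
  have : extendZero d N (φ + ψ) = extendZero d N φ + extendZero d N ψ := by
    funext x
    simp only [extendZero, Pi.add_apply]
    split_ifs <;> simp
  ext p
  simp only [configVec, gradVec_apply, this, Pi.add_apply, lp.coeFn_add]
  ring

theorem inner_configVec_greenVec (hd : 5 ≤ d) (N : ℕ) (φ : box d N → ℝ) (y : box d N) :
    inner ℝ (configVec N φ) (greenVec N (y : Site d)) = φ y :=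
  (inner_gradVec_greenVec hd (finite_support_extendZero N φ) (fun _ hz => dif_neg hz) _).trans
    (extendZero_coe N φ y)

/-- The field `G_N t` on `Λ_N`. -/
def potential (N : ℕ) (t : box d N → ℝ) (x : box d N) : ℝ := ∑ y : box d N, killGreen N (x : Site d) y * t y

theorem configVec_potential (N : ℕ) (t : box d N → ℝ) :
    configVec N (potential N t) = ∑ y : box d N, t y • greenVec N (y : Site d) := by
  have : ∀ z, extendZero d N (potential N t) z = ∑ y : box d N, killGreen N z y * t y := fun z => by
    by_cases hz : z ∈ box d N
    · rw [extendZero, dif_pos hz, potential]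
    · simp [extendZero, hz, killGreen_of_notMem_left hz]
  ext p
  rw [configVec, gradVec_apply, this, this, lp.coeFn_sum, Finset.sum_apply,
    ← Finset.sum_sub_distrib, Finset.mul_sum]
  refine Finset.sum_congr rfl fun y _ => ?_
  rw [lp.coeFn_smul, Pi.smul_apply, greenVec, gradVec_apply, smul_eq_mul]
  ring

/-- The exponent of the Gibbs measure. -/
def gibbsExponent (N : ℕ) (η : Site d → ℝ) (φ : box d N → ℝ) : ℝ :=
  -hamiltonian d N φ + ∑ x : box d N, η x * φ x

theorem continuous_extendZero (N : ℕ) : Continuous (extendZero d N) := by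
  refine continuous_pi fun x => ?_
  by_cases h : x ∈ box d N
  · simp only [extendZero, h, dif_pos]; fun_prop
  · simp only [extendZero, h, dif_neg, not_false_eq_true]; fun_prop

theorem continuous_gibbsExponent (N : ℕ) (η : Site d → ℝ) : Continuous (gibbsExponent N η) := by
  have h : ∀ x, Continuous fun φ : box d N → ℝ => extendZero d N φ x := fun x =>
    (continuous_apply x).comp (continuous_extendZero N)
  unfold gibbsExponent hamiltonian
  refine Continuous.add (Continuous.neg ?_) (by fun_prop)
  refine continuous_const.mul (continuous_const.mul (continuous_finsetSum _ fun p _ => ?_))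
  exact ((h p.1).sub (h p.2)).pow 2

theorem gibbsExponent_eq (N : ℕ) (η : Site d → ℝ) (φ : box d N → ℝ) :
    gibbsExponent N η φ = -(1 / 2 * ‖configVec N φ‖ ^ 2) + ∑ x : box d N, η x * φ x := by
  rw [gibbsExponent, hamiltonian_eq, configVec]

theorem inner_configVec_potential (hd : 5 ≤ d) (N : ℕ) (φ t : box d N → ℝ) :
    inner ℝ (configVec N φ) (configVec N (potential N t)) = ∑ y : box d N, t y * φ y := by
  rw [configVec_potential, inner_sum]
  refine Finset.sum_congr rfl fun y _ => ?_
  rw [real_inner_smul_right, inner_configVec_greenVec hd]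

/-- Completing the square: the shift by G_N t cancels the linear term, because ⟨∇φ, ∇G_N t⟩ = ⟨φ,
t⟩. -/
theorem gibbsExponent_add_potential (hd : 5 ≤ d) (N : ℕ) (η : Site d → ℝ) (φ t : box d N → ℝ) :
    gibbsExponent N η (φ + potential N t) + ∑ y : box d N, t y * (φ + potential N t) y =
      gibbsExponent N η φ + (∑ x : box d N, η x * potential N t x +
        ‖∑ y : box d N, t y • greenVec N (y : Site d)‖ ^ 2 / 2) := by
  have h1 := inner_configVec_potential hd N φ t
  have h2 := inner_configVec_potential hd N (potential N t) t
  rw [real_inner_self_eq_norm_sq] at h2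
  rw [gibbsExponent_eq, gibbsExponent_eq, configVec_add, norm_add_sq_real, h1,
    ← configVec_potential]
  simp only [Pi.add_apply, mul_add, Finset.sum_add_distrib]
  rw [← h2]
  ring

/-- Coercivity comes from the reproducing identity: Cauchy–Schwarz gives φ(y)² ≤ G_N(y,y) |∇φ|², and
summing over the box bounds Σ φ² by the Dirichlet form. -/
theorem integrable_exp_gibbsExponent (hd : 5 ≤ d) (N : ℕ) (η : Site d → ℝ) :
    Integrable fun φ : box d N → ℝ => Real.exp (gibbsExponent N η φ) := by
  set T : ℝ := ∑ y : box d N, killGreen N (y : Site d) y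
  have hT : 0 ≤ T := Finset.sum_nonneg fun y _ => killGreen_nonneg _ _ _
  -- Chosen so that 2b(T + 1) = 1/2: one share b Σ φ² absorbs the field term by AM–GM, the other
  -- remains as Gaussian decay.
  set b : ℝ := 1 / (4 * (T + 1))
  have hb : 0 < b := by positivity
  have hsq : ∀ φ : box d N → ℝ, ∑ y, φ y ^ 2 ≤ (T + 1) * ‖configVec N φ‖ ^ 2 := fun φ => by
    calc ∑ y, φ y ^ 2 ≤ ∑ y : box d N, killGreen N (y : Site d) y * ‖configVec N φ‖ ^ 2 := by
          refine Finset.sum_le_sum fun y _ => ?_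
          have h1 := abs_real_inner_le_norm (configVec N φ) (greenVec N (y : Site d))
          rw [inner_configVec_greenVec hd] at h1
          calc φ y ^ 2 = |φ y| ^ 2 := (sq_abs _).symm
            _ ≤ (‖configVec N φ‖ * ‖greenVec N (y : Site d)‖) ^ 2 := by gcongr
            _ = _ := by
              rw [mul_pow, ← real_inner_self_eq_norm_sq (greenVec N (y : Site d)),
                inner_greenVec hd le_rfl, mul_comm]
      _ = T * ‖configVec N φ‖ ^ 2 := by rw [← Finset.sum_mul]
      _ ≤ _ := by gcongr; linarith
  have hint : Integrable fun φ : box d N → ℝ =>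
      ∏ y : box d N, Real.exp (η y ^ 2 / (4 * b)) * Real.exp (-b * φ y ^ 2) := by
    rw [volume_pi]
    exact Integrable.fintype_prod (𝕜 := ℝ)
      (f := fun (y : box d N) (r : ℝ) => Real.exp (η y ^ 2 / (4 * b)) * Real.exp (-b * r ^ 2))
      fun y => (integrable_exp_neg_mul_sq hb).const_mul _
  refine hint.mono' (Real.continuous_exp.comp
    (continuous_gibbsExponent N η)).aestronglyMeasurable (Eventually.of_forall fun φ => ?_)
  rw [Real.norm_of_nonneg (Real.exp_pos _).le]
  simp_rw [← Real.exp_add]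
  rw [← Real.exp_sum, Real.exp_le_exp, gibbsExponent_eq]
  have h1 : 2 * b * ∑ y, φ y ^ 2 ≤ 1 / 2 * ‖configVec N φ‖ ^ 2 := by
    calc _ ≤ 2 * b * ((T + 1) * ‖configVec N φ‖ ^ 2) := by gcongr; exact hsq φ
      _ = _ := by simp only [b]; field_simp; ring
  have h2 : ∑ y : box d N, η y * φ y ≤ ∑ y : box d N, (η y ^ 2 / (4 * b) + b * φ y ^ 2) := by
    refine Finset.sum_le_sum fun y _ => ?_
    have : η y ^ 2 / (4 * b) + b * φ y ^ 2 - η y * φ y = (η y - 2 * b * φ y) ^ 2 / (4 * b) := by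
      field_simp
      ring
    have h0 : 0 ≤ (η y - 2 * b * φ y) ^ 2 / (4 * b) := by positivity
    linarith
  have h3 : ∑ y : box d N, (η y ^ 2 / (4 * b) + -b * φ y ^ 2) =
      ∑ y : box d N, (η y ^ 2 / (4 * b) + b * φ y ^ 2) - 2 * b * ∑ y, φ y ^ 2 := by
    rw [Finset.mul_sum, ← Finset.sum_sub_distrib]
    exact Finset.sum_congr rfl fun y _ => by ring
  rw [h3]
  linarith

theorem gibbsBox_eq (N : ℕ) (η : Site d → ℝ) :
    gibbsBox d N η = (volume : Measure (box d N → ℝ)).tilted (gibbsExponent N η) := rfl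

theorem isProbabilityMeasure_gibbsBox (hd : 5 ≤ d) (N : ℕ) (η : Site d → ℝ) :
    IsProbabilityMeasure (gibbsBox d N η) := by
  rw [gibbsBox_eq]
  exact isProbabilityMeasure_tilted (integrable_exp_gibbsExponent hd N η)

theorem isProbabilityMeasure_gibbs (hd : 5 ≤ d) (N : ℕ) (η : Site d → ℝ) :
    IsProbabilityMeasure (gibbs d N η) :=
  have := isProbabilityMeasure_gibbsBox hd N η
  Measure.isProbabilityMeasure_map (continuous_extendZero N).measurable.aemeasurable

/-- Translating Lebesgue measure by G_N t turns the numerator into a constant multiple of the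
partition function. -/
theorem integral_exp_sum_gibbsBox (hd : 5 ≤ d) (N : ℕ) (η : Site d → ℝ) (t : box d N → ℝ) :
    ∫ φ, Real.exp (∑ y, t y * φ y) ∂gibbsBox d N η =
      Real.exp (∑ x : box d N, η x * potential N t x +
        ‖∑ y : box d N, t y • greenVec N (y : Site d)‖ ^ 2 / 2) := by
  rw [gibbsBox_eq, integral_exp_tilted]
  have hpos : 0 < ∫ φ : box d N → ℝ, Real.exp (gibbsExponent N η φ) :=
    integral_exp_pos (integrable_exp_gibbsExponent hd N η)
  rw [div_eq_iff hpos.ne', ← integral_add_right_eq_self _ (potential N t), ← integral_const_mul]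
  congr 1
  funext φ
  rw [← Real.exp_add, Pi.add_apply, gibbsExponent_add_potential hd, add_comm]

theorem map_sum_mul_gibbsBox (hd : 5 ≤ d) (N : ℕ) (η : Site d → ℝ) (t : box d N → ℝ) :
    (gibbsBox d N η).map (fun φ => ∑ y, t y * φ y) =
      gaussianReal (∑ y : box d N, t y * ∑ x ∈ box d N, killGreen N (y : Site d) x * η x)
        (‖∑ y : box d N, t y • greenVec N (y : Site d)‖ ^ 2).toNNReal := by
  have := isProbabilityMeasure_gibbsBox hd N η
  have hmeas : Measurable fun φ : box d N → ℝ => ∑ y, t y * φ y :=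
    Finset.measurable_sum _ fun y _ => (measurable_pi_apply y).const_mul _
  refine map_eq_gaussianReal_of_mgf hmeas.aemeasurable fun s => ?_
  have h := integral_exp_sum_gibbsBox hd N η (s • t)
  have h1 : ∀ φ : box d N → ℝ, ∑ y, (s • t) y * φ y = s * ∑ y, t y * φ y := fun φ => by
    rw [Finset.mul_sum]
    exact Finset.sum_congr rfl fun y _ => by rw [Pi.smul_apply, smul_eq_mul]; ring
  simp_rw [h1] at h
  rw [mgf, h, Real.coe_toNNReal _ (sq_nonneg _)]
  have h2 : ∑ y : box d N, (s • t) y • greenVec N (y : Site d) =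
      s • ∑ y : box d N, t y • greenVec N (y : Site d) := by
    rw [Finset.smul_sum]
    exact Finset.sum_congr rfl fun y _ => by rw [Pi.smul_apply, smul_assoc]
  have h3 : ∑ x : box d N, η x * potential N (s • t) x =
      (∑ y : box d N, t y * ∑ x ∈ box d N, killGreen N (y : Site d) x * η x) * s := by
    simp_rw [potential, ← Finset.sum_coe_sort (box d N), Finset.mul_sum, Finset.sum_mul]
    rw [Finset.sum_comm]
    refine Finset.sum_congr rfl fun y _ => Finset.sum_congr rfl fun x _ => ?_
    rw [killGreen_comm hd N x y, Pi.smul_apply, smul_eq_mul]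
    ring
  rw [h2, h3, norm_smul, mul_pow, Real.norm_eq_abs, sq_abs]
  ring_nf

/-- The Cramér–Wold device. -/
theorem ext_of_map_sum_mul {κ : Type*} [Fintype κ] {μ ν : Measure (κ → ℝ)} [IsFiniteMeasure μ]
    [IsFiniteMeasure ν] (h : ∀ t : κ → ℝ, μ.map (fun φ => ∑ x, t x * φ x) =
      ν.map fun φ => ∑ x, t x * φ x) : μ = ν := by
  classical
  refine Measure.ext_of_charFunDual (funext fun L => ?_)
  have hL : ⇑L = fun φ => ∑ x, L (fun j => if x = j then 1 else 0) * φ x := funext fun φ =>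
    (LinearMap.pi_apply_eq_sum_univ L.toLinearMap φ).trans
      (Finset.sum_congr rfl fun x _ => by rw [smul_eq_mul, mul_comm]; rfl)
  rw [charFunDual_eq_charFun_map_one, charFunDual_eq_charFun_map_one, hL, h]

/-- On the box the laws agree because all linear functionals do; outside it the mean vanishes and
the driving vector has squared norm G_N(x,x) = 0. -/
theorem gibbs_eq_map_field (hd : 5 ≤ d) {Ω : Type*} [MeasurableSpace Ω] {P : Measure Ω}
    [IsProbabilityMeasure P] {W : lp (fun _ : Fin d × Site d => ℝ) 2 →ₗᵢ[ℝ] Lp ℝ 2 P}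
    (hW : IsIsonormal W) (N : ℕ) (η : Site d → ℝ) :
    gibbs d N η = P.map (field W (fun x => ∑ y ∈ box d N, killGreen N x y * η y) (greenVec N)) := by
  set m : Site d → ℝ := fun x => ∑ y ∈ box d N, killGreen N x y * η y with hm
  have hmb := measurable_field (W := W) (fun x : box d N => m x) fun x : box d N => greenVec N x
  have := isProbabilityMeasure_gibbsBox hd N η
  have : IsProbabilityMeasure
      (P.map (field W (fun x : box d N => m x) fun x : box d N => greenVec N x)) :=
    Measure.isProbabilityMeasure_map hmb.aemeasurable
  have hbox : gibbsBox d N η =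
      P.map (field W (fun x : box d N => m x) fun x : box d N => greenVec N x) := by
    refine ext_of_map_sum_mul fun t => ?_
    rw [map_sum_mul_gibbsBox hd, Measure.map_map (by fun_prop) hmb]
    exact (map_sum_mul_field hW _ _ t).symm
  rw [gibbs, hbox, Measure.map_map (continuous_extendZero N).measurable hmb]
  refine Measure.map_congr ?_
  have hzero : ∀ᵐ ω ∂P, ∀ x : Site d, x ∉ box d N → W (greenVec N x) ω = 0 := by
    rw [ae_all_iff]
    intro x
    by_cases hx : x ∈ box d N
    · exact Eventually.of_forall fun ω h => absurd hx h
    · have h0 : greenVec N x = 0 := by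
        rw [← norm_eq_zero, ← sq_eq_zero_iff, ← real_inner_self_eq_norm_sq,
          inner_greenVec hd le_rfl, killGreen_of_notMem_left hx]
      rw [h0, map_zero]
      filter_upwards [Lp.coeFn_zero ℝ 2 P] with ω hω _
      exact hω
  filter_upwards [hzero] with ω hω
  funext x
  by_cases hx : x ∈ box d N
  · simp [extendZero, hx, field]
  · have : m x = 0 := Finset.sum_eq_zero fun y _ => by
      rw [killGreen_of_notMem_left hx, zero_mul]
    simp [extendZero, hx, field, this, hω x hx]

/-! ### Convergence of the means -/

theorem ae_exists_tendsto_mean (hd : 5 ≤ d) {Ω : Type*} [MeasurableSpace Ω] {P : Measure Ω}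
    {η : Site d → Ω → ℝ} {σ2 : ℝ} (hL2 : ∀ x, MemLp (η x) 2 P)
    (hvar : ∀ x, ∫ ω, η x ω ^ 2 ∂P = σ2)
    (horth : ∀ x y, x ≠ y → ∫ ω, η x ω * η y ω ∂P = 0) (hσ : 0 ≤ σ2) (x : Site d) :
    ∀ᵐ ω ∂P, ∃ l,
      Tendsto (fun M => ∑ y ∈ box d M, green x y * η y ω) atTop (𝓝 l) ∧
      Tendsto (fun N => ∑ y ∈ box d N, killGreen N x y * η y ω) atTop (𝓝 l) := by
  obtain ⟨R, hR⟩ := exists_mem_box x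
  obtain ⟨C, -, hC⟩ := exists_sum_greenTail_sq_le hd
  -- Shifting the box by R makes the tail start at N + 1 ≥ 1, uniformly in y, since x lies in Λ_R.
  have htail : ∀ N y, green x y - killGreen (N + R) x y ≤ greenTail (N + 1) x y := fun N y =>
    green_sub_killGreen_le hd hR (by omega) y
  have hbound : ∀ (c : Site d → ℝ) (N : ℕ) (S : Finset (Site d)), (∀ y, 0 ≤ c y) →
      (∀ y, c y ≤ greenTail (N + 1) x y) →
      ∑ y ∈ S, c y ^ 2 ≤ C * (1 / ((N : ℝ) + 1) ^ (1 / 4 : ℝ)) := fun c N S h0 h1 => by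
    calc _ ≤ ∑ y ∈ S, greenTail (N + 1) x y ^ 2 :=
          Finset.sum_le_sum fun y _ => pow_le_pow_left₀ (h0 y) (h1 y) 2
      _ ≤ _ := by
          have := hC (N + 1) (by omega) S x
          push_cast at this
          exact this
  have hBmono : Monotone fun N : ℕ => box d (N + R) := fun M N h => box_mono (by omega)
  have hgreen : ∀ y, 0 ≤ green x y := fun y => tsum_nonneg fun _ => walkProb_nonneg _ _ _
  have hA := ae_exists_tendsto_of_monotone hL2 hvar horth hσ
    (a := fun N y => killGreen (N + R) x y) (B := fun N => box d (N + R)) (C := C)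
    (fun M N h y => killGreen_mono hd (by omega) x y) hBmono
    (fun N y hy => killGreen_of_notMem_right hy x)
    (fun N M h S => hbound _ N S
      (fun y => sub_nonneg.2 (killGreen_mono hd (by omega) x y)) fun y =>
        (sub_le_sub_right (killGreen_le_green hd _ x y) _).trans (htail N y))
  -- The cut-off Green function is also increasing in N, and off Λ_{N+R} the Green function equals
  -- its own tail.
  have hB := ae_exists_tendsto_of_monotone hL2 hvar horth hσ
    (a := fun N y => if y ∈ box d (N + R) then green x y else 0)
    (B := fun N => box d (N + R)) (C := C)
    (fun M N h y => by
      simp only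
      split_ifs with h1 h2
      · exact le_rfl
      · exact absurd (box_mono (by omega) h1) h2
      · exact hgreen y
      · exact le_rfl) hBmono
    (fun N y hy => if_neg hy)
    (fun N M h S => hbound _ N S
      (fun y => by
        split_ifs with h1 h2 h2
        · simp
        · simpa using hgreen y
        · exact absurd (box_mono (by omega) h2) h1
        · simp) fun y => by
        by_cases h2 : y ∈ box d (N + R)
        · rw [if_pos h2, if_pos (box_mono (by omega) h2), sub_self]
          exact greenTail_nonneg _ _ _
        · rw [if_neg h2, sub_zero, ← green_eq_greenTail hd hR (by omega) h2]
          split_ifs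
          · exact le_rfl
          · exact hgreen y)
  have hD := ae_tendsto_zero_two_pow hL2 hvar horth hσ
    (c := fun N y => green x y - killGreen (N + R) x y) (B := fun N => box d (N + R)) (C := C)
    fun N => hbound _ N _ (fun y => sub_nonneg.2 (killGreen_le_green hd _ x y)) (htail N)
  filter_upwards [hA, hB, hD] with ω ⟨l, hl⟩ ⟨l', hl'⟩ h0
  have hl'' : Tendsto (fun N => ∑ y ∈ box d (N + R), green x y * η y ω) atTop (𝓝 l') := by
    refine hl'.congr fun N => Finset.sum_congr rfl fun y hy => ?_
    rw [if_pos hy]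
  have hpow : Tendsto (fun k : ℕ => 2 ^ k) atTop atTop :=
    tendsto_pow_atTop_atTop_of_one_lt (by norm_num : 1 < 2)
  have h1 := (hl''.comp hpow).sub (hl.comp hpow)
  have heq : l' - l = 0 := by
    refine tendsto_nhds_unique h1 (h0.congr fun k => ?_)
    simp only [Function.comp_apply]
    rw [← Finset.sum_sub_distrib]
    exact Finset.sum_congr rfl fun y _ => by ring
  obtain rfl : l' = l := sub_eq_zero.1 heq
  exact ⟨l', (tendsto_add_atTop_iff_nat (f := fun M => ∑ y ∈ box d M, green x y * η y ω) R).1 hl'',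
    (tendsto_add_atTop_iff_nat
      (f := fun N => ∑ y ∈ box d N, killGreen N x y * η y ω) R).1 hl⟩

end gibbs

end DisorderedGFF

end

/-! ### Assembly of the theorem -/

theorem propositionA1 {d : ℕ} (hd : 5 ≤ d)
    {Ω : Type*} [MeasurableSpace Ω] (P : Measure Ω) [IsProbabilityMeasure P]
    (η : DisorderedGFF.Site d → Ω → ℝ)
    (hmeas : ∀ x, Measurable (η x))
    (hindep : iIndepFun η P)
    (hident : ∀ x y, IdentDistrib (η x) (η y) P P)
    (hL2 : ∀ x, MemLp (η x) 2 P)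
    (hmean : ∀ x, ∫ ω, η x ω ∂P = 0) :
    (∀ x y : DisorderedGFF.Site d,
      Summable fun n : ℕ => DisorderedGFF.walkProb n x y) ∧
    ∀ᵐ ω ∂P,
      ∃ m : DisorderedGFF.Site d → ℝ,
        (∀ x, Tendsto
          (fun M : ℕ => ∑ y ∈ DisorderedGFF.box d M, DisorderedGFF.green x y * η y ω)
          atTop (𝓝 (m x))) ∧
        ∃ μ : ProbabilityMeasure (DisorderedGFF.Site d → ℝ),
          DisorderedGFF.IsGaussianField (μ : Measure (DisorderedGFF.Site d → ℝ)) m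
            DisorderedGFF.green ∧
          ∃ hprob : ∀ N : ℕ, IsProbabilityMeasure (DisorderedGFF.gibbs d N fun x => η x ω),
            Tendsto (β := ProbabilityMeasure (DisorderedGFF.Site d → ℝ))
              (fun N : ℕ => ⟨DisorderedGFF.gibbs d N fun x => η x ω, hprob N⟩)
              atTop (𝓝 μ) := by
  refine ⟨fun x y => DisorderedGFF.summable_walkProb hd x y, ?_⟩
  have hvar : ∀ x, ∫ ω, η x ω ^ 2 ∂P = ∫ ω, η 0 ω ^ 2 ∂P := fun x =>
    ((hident x 0).comp (measurable_id.pow_const 2)).integral_eq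
  have horth : ∀ x y, x ≠ y → ∫ ω, η x ω * η y ω ∂P = 0 := fun x y hxy => by
    have := (hindep.indepFun hxy).integral_mul_eq_mul_integral (hmeas x).aestronglyMeasurable
      (hmeas y).aestronglyMeasurable
    simp only [Pi.mul_apply] at this
    rw [this, hmean x, zero_mul]
  have hae := ae_all_iff.2 fun x => DisorderedGFF.ae_exists_tendsto_mean hd hL2 hvar horth
    (integral_nonneg fun ω => sq_nonneg (η 0 ω)) x
  -- The process W and the limit vectors do not depend on the disorder; only the means require
  -- discarding a null set, one for each of countably many sites.
  obtain ⟨Ω', mΩ', P', hP', W, hW⟩ :=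
    DisorderedGFF.exists_isonormal (Fin d × DisorderedGFF.Site d)
  choose v hv using DisorderedGFF.exists_tendsto_greenVec hd
  filter_upwards [hae] with ω hω
  choose m hm using hω
  refine ⟨m, fun x => (hm x).1, ⟨P'.map (DisorderedGFF.field W m v),
    Measure.isProbabilityMeasure_map (DisorderedGFF.measurable_field m v).aemeasurable⟩, ?_,
    fun N => DisorderedGFF.isProbabilityMeasure_gibbs hd N _, ?_⟩
  · have h := DisorderedGFF.isGaussianField_map_field hW m v
    simp_rw [DisorderedGFF.inner_eq_green_of_tendsto hd hv] at h
    exact h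
  · refine (DisorderedGFF.tendsto_map_field (W := W) (fun x => (hm x).2) hv).congr fun N => ?_
    exact Subtype.ext (DisorderedGFF.gibbs_eq_map_field hd hW N fun x => η x ω).symm
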